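/- Let $d\ge 1$ and let $A$ be a $d\times d$ integral matrix with $|\det A|=2$ which is expansive, that is, all of whose complex eigenvalues have modulus $>1$. Assume that $A\mathbb{Z}^d=A^{\tau}\mathbb{Z}^d$ (where $A^\tau$ is the transpose), and that there are $\vec\ell_A,\vec q_A\in\mathbb{Z}^d$ such that $\mathbb{Z}^d$ is the disjoint union of $\vec\ell_A+A\mathbb{Z}^d$ and $A\mathbb{Z}^d$, with $\vec q_A\circ\vec n$ even for all $\vec n\in A\mathbb{Z}^d$ and odd for all $\vec n\in\vec\ell_A+A\mathbb{Z}^d$ (here $\circ$ is the standard dot product). Let $\{h_{\vec n}\}_{\vec n\in\mathbb{Z}^d}$ be a finitely supported family of complex numbers satisfying Lawton's equations $$\sum_{\vec n\in\mathbb{Z}^d}h_{\vec n}\overline{h_{\vec n+\vec k}}=\delta_{\vec 0\vec k}\quad(\vec k\in A\mathbb{Z}^d),\qquad \sum_{\vec n\in\mathbb{Z}^d}h_{\vec n}=\sqrt2 .$$ Put $$m_0(\vec t)=\frac1{\sqrt2}\sum_{\vec n}h_{\vec n}e^{-i\vec n\circ\vec t},\qquad g(\vec\xi)=\frac1{(2\pi)^{d/2}}\prod_{j=1}^{\infty}m_0\big((A^\tau)^{-j}\vec\xi\big)\qquad(\vec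 t,\vec\xi\in\mathbb{R}^d).$$ Then the infinite product converges at every $\vec\xi\in\mathbb{R}^d$ and $g\in L^2(\mathbb{R}^d)$. Let $\varphi=\mathcal F^{-1}g\in L^2(\mathbb{R}^d)$ be the scaling function, where $\mathcal F$ is the unitary Fourier transform on $L^2(\mathbb{R}^d)$ that extends $(\mathcal F f)(\vec s)=(2\pi)^{-d/2}\int_{\mathbb{R}^d}e^{-i\vec s\circ\vec t}f(\vec t)\,d\vec t$. Let $T_{\vec\ell}f(\vec t)=f(\vec t-\vec\ell)$ and let $D_A$ be the unitary operator $D_Af(\vec t)=\sqrt{|\det A|}\,f(A\vec t)$ on $L^2(\mathbb{R}^d)$. For $f\in L^2(\mathbb{R}^d)$ and $J\in\mathbb{Z}$ put $$L_J(f)=\sum_{\vec\ell\in\mathbb{Z}^d}\big|\langle f,D_A^JT_{\vec\ell}\,\varphi\rangle\big|^2 .$$ Then for every $f\in L^2(\mathbb{R}^d)$ the series $L_J(f)$ converges for every $J\in\mathbb{Z}$, and $$\lim_{J\to+\infty}L_J(f)=\|f\|^2,\qquad \lim_{J\to-\infty}L_J(f)=0 .$$ -/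

import Mathlib

noncomputable section

namespace ParsevalWavelet

open MeasureTheory Matrix
open scoped FourierTransform ENNReal

/-- The Euclidean space `ℝ^d`. -/
abbrev Rd (d : ℕ) : Type := EuclideanSpace ℝ (Fin d)

/-- The Hilbert space `L²(ℝ^d)` of complex-valued functions (Lebesgue measure). -/
abbrev L2 (d : ℕ) : Type := Lp ℂ 2 (volume : Measure (Rd d))

/-- An integral matrix regarded as a real matrix. -/
def realMat {d : ℕ} (A : Matrix (Fin d) (Fin d) ℤ) : Matrix (Fin d) (Fin d) ℝ :=
  A.map (Int.cast : ℤ → ℝ)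

/-- `A` is expansive: every complex eigenvalue has modulus larger than `1`. -/
def IsExpansive {d : ℕ} (A : Matrix (Fin d) (Fin d) ℤ) : Prop :=
  ∀ β ∈ spectrum ℂ (A.map (Int.cast : ℤ → ℂ)), 1 < ‖β‖

/-- The sublattice `A ℤ^d` of `ℤ^d`. -/
def latticeImage {d : ℕ} (A : Matrix (Fin d) (Fin d) ℤ) : Set (Fin d → ℤ) :=
  Set.range fun n : Fin d → ℤ => A *ᵥ n

/-- The lattice properties that are standing assumptions on `A`: `A ℤ^d = Aᵀ ℤ^d`, and there are
`ℓ, q ∈ ℤ^d` such that `ℤ^d` is the disjoint union of `ℓ + A ℤ^d` and `A ℤ^d`, the integer `q ∘ n`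
being even on `A ℤ^d` and odd on `ℓ + A ℤ^d`. -/
def HasPartition {d : ℕ} (A : Matrix (Fin d) (Fin d) ℤ) : Prop :=
  latticeImage A = latticeImage Aᵀ ∧
  ∃ ℓ q : Fin d → ℤ,
    ((fun n => ℓ + n) '' latticeImage A) ∪ latticeImage A = Set.univ ∧
    Disjoint ((fun n => ℓ + n) '' latticeImage A) (latticeImage A) ∧
    (∀ n ∈ latticeImage A, Even (q ⬝ᵥ n)) ∧
    (∀ n ∈ (fun n => ℓ + n) '' latticeImage A, Odd (q ⬝ᵥ n))

/-- `h` is a finite (that is, finitely supported) solution to Lawton's equations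
associated with `A`. -/
def IsLawtonSolution {d : ℕ} (A : Matrix (Fin d) (Fin d) ℤ) (h : (Fin d → ℤ) →₀ ℂ) : Prop :=
  (∀ k ∈ latticeImage A,
    (h.sum fun n c => c * (starRingEnd ℂ) (h (n + k))) = if k = 0 then 1 else 0) ∧
  (h.sum fun _ c => c) = (Real.sqrt 2 : ℂ)

/-- The filter function `m₀(t) = 2^{-1/2} ∑ₙ hₙ e^{-i n∘t}`. -/
def filterFun {d : ℕ} (h : (Fin d → ℤ) →₀ ℂ) (t : Rd d) : ℂ :=
  (1 / (Real.sqrt 2 : ℂ)) *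
    h.sum fun n c => c * Complex.exp (-Complex.I * ((∑ i, (n i : ℝ) * t i : ℝ) : ℂ))

/-- The `j`-th factor `m₀((Aᵀ)^{-j} ξ)` of the infinite product. -/
def factor {d : ℕ} (A : Matrix (Fin d) (Fin d) ℤ) (h : (Fin d → ℤ) →₀ ℂ) (ξ : Rd d) (j : ℕ) : ℂ :=
  filterFun h (toEuclideanLin (((realMat A)ᵀ)⁻¹ ^ j) ξ)

/-- `g(ξ) = (2π)^{-d/2} ∏_{j ≥ 1} m₀((Aᵀ)^{-j} ξ)`. -/
def gFun {d : ℕ} (A : Matrix (Fin d) (Fin d) ℤ) (h : (Fin d → ℤ) →₀ ℂ) (ξ : Rd d) : ℂ :=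
  (1 / (((2 * Real.pi) ^ ((d : ℝ) / 2) : ℝ) : ℂ)) * ∏' j : ℕ, factor A h ξ (j + 1)

section UnitaryOperators

variable {d : ℕ}

theorem det_toEuclideanLin (M : Matrix (Fin d) (Fin d) ℝ) :
    LinearMap.det (toEuclideanLin M : Rd d →ₗ[ℝ] Rd d) = M.det := by
  rw [toEuclideanLin, toLpLin_eq_toLin, LinearMap.det_toLin]

theorem map_toEuclideanLin (M : Matrix (Fin d) (Fin d) ℝ) (hM : M.det ≠ 0) :
    Measure.map (toEuclideanLin M : Rd d → Rd d) volume
      = ENNReal.ofReal |M.det⁻¹| • (volume : Measure (Rd d)) := by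
  have := Measure.map_linearMap_addHaar_eq_smul_addHaar (volume : Measure (Rd d))
    (f := toEuclideanLin M) (by rwa [det_toEuclideanLin])
  rwa [det_toEuclideanLin] at this

theorem measurable_toEuclideanLin (M : Matrix (Fin d) (Fin d) ℝ) :
    Measurable (toEuclideanLin M : Rd d → Rd d) :=
  (LinearMap.continuous_of_finiteDimensional _).measurable

theorem quasiMeasurePreserving_toEuclideanLin (M : Matrix (Fin d) (Fin d) ℝ) (hM : M.det ≠ 0) :
    Measure.QuasiMeasurePreserving (toEuclideanLin M : Rd d → Rd d) volume volume :=
  ⟨measurable_toEuclideanLin M, by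
    rw [map_toEuclideanLin M hM]; exact Measure.smul_absolutelyContinuous⟩

theorem eLpNorm_comp_toEuclideanLin (M : Matrix (Fin d) (Fin d) ℝ) (hM : M.det ≠ 0)
    {f : Rd d → ℂ} (hf : AEStronglyMeasurable f volume) :
    eLpNorm (fun t => (Real.sqrt |M.det| : ℂ) * f (toEuclideanLin M t)) 2 volume
      = eLpNorm f 2 volume := by
  have h1 : eLpNorm (fun t => f (toEuclideanLin M t)) 2 volume
      = ENNReal.ofReal |M.det⁻¹| ^ (1 / 2 : ℝ) * eLpNorm f 2 volume := by
    have h2 := eLpNorm_map_measure (p := 2) (μ := (volume : Measure (Rd d)))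
      (f := (toEuclideanLin M : Rd d → Rd d)) (g := f)
      (by rw [map_toEuclideanLin M hM]; exact hf.mono_ac Measure.smul_absolutelyContinuous)
      (measurable_toEuclideanLin M).aemeasurable
    rw [map_toEuclideanLin M hM, eLpNorm_smul_measure_of_ne_top (by simp)] at h2
    simpa [Function.comp_def] using h2.symm
  have h3 : (fun t => (Real.sqrt |M.det| : ℂ) * f (toEuclideanLin M t))
      = (Real.sqrt |M.det| : ℂ) • fun t => f (toEuclideanLin M t) := rfl
  rw [h3, eLpNorm_const_smul, h1, ← mul_assoc]
  have h4 : ‖(Real.sqrt |M.det| : ℂ)‖ₑ * ENNReal.ofReal |M.det⁻¹| ^ (1 / 2 : ℝ) = 1 := by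
    have hpos : 0 < |M.det| := abs_pos.mpr hM
    rw [← ofReal_norm, Complex.norm_real, Real.norm_of_nonneg (Real.sqrt_nonneg _),
      ENNReal.ofReal_rpow_of_nonneg (abs_nonneg _) (by norm_num),
      ← ENNReal.ofReal_mul (Real.sqrt_nonneg _), ← Real.sqrt_eq_rpow, abs_inv,
      ← Real.sqrt_mul hpos.le, mul_inv_cancel₀ hpos.ne']
    simp
  rw [h4, one_mul]

theorem memLp_comp_toEuclideanLin (M : Matrix (Fin d) (Fin d) ℝ) (hM : M.det ≠ 0) (f : L2 d) :
    MemLp (fun t => (Real.sqrt |M.det| : ℂ) * f (toEuclideanLin M t)) 2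
      (volume : Measure (Rd d)) := by
  have hf := Lp.memLp f
  refine ⟨?_, ?_⟩
  · exact (hf.1.comp_quasiMeasurePreserving
      (quasiMeasurePreserving_toEuclideanLin M hM)).const_mul _
  · rw [eLpNorm_comp_toEuclideanLin M hM hf.1]
    exact hf.2

/-- The function `(U_M f)(t) = √|det M| f(M t)` as an element of `L²(ℝ^d)`. -/
def UFun (M : Matrix (Fin d) (Fin d) ℝ) (hM : M.det ≠ 0) (f : L2 d) : L2 d :=
  (memLp_comp_toEuclideanLin M hM f).toLp _

theorem coeFn_UFun (M : Matrix (Fin d) (Fin d) ℝ) (hM : M.det ≠ 0) (f : L2 d) :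
    (UFun M hM f : Rd d → ℂ)
      =ᵐ[volume] fun t => (Real.sqrt |M.det| : ℂ) * f (toEuclideanLin M t) :=
  MemLp.coeFn_toLp _

theorem UFun_UFun (M N : Matrix (Fin d) (Fin d) ℝ) (hM : M.det ≠ 0) (hN : N.det ≠ 0)
    (hMN : M * N = 1) (f : L2 d) : UFun N hN (UFun M hM f) = f := by
  apply Lp.ext
  have h1 := coeFn_UFun N hN (UFun M hM f)
  have h2 := (quasiMeasurePreserving_toEuclideanLin N hN).ae (coeFn_UFun M hM f)
  filter_upwards [h1, h2] with t h1 h2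
  rw [h1, h2, ← mul_assoc, ← Complex.ofReal_mul, ← Real.sqrt_mul (abs_nonneg _), ← abs_mul,
    ← det_mul, mul_eq_one_comm.mp hMN]
  have h3 : toEuclideanLin M (toEuclideanLin N t) = t := by
    ext i
    simp [toLpLin_apply, mulVec_mulVec, hMN]
  rw [h3]
  simp

/-- The unitary operator `U_M` on `L²(ℝ^d)`, `(U_M f)(t) = √|det M| f(M t)`, for an invertible real
matrix `M`. -/
def U (M : Matrix (Fin d) (Fin d) ℝ) (hM : M.det ≠ 0) : L2 d ≃ₗᵢ[ℂ] L2 d where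
  toFun := UFun M hM
  invFun := UFun M⁻¹ (by rw [det_nonsing_inv]; simpa using hM)
  left_inv f := UFun_UFun M M⁻¹ hM _ (mul_nonsing_inv M (Ne.isUnit hM)) f
  right_inv f := UFun_UFun M⁻¹ M _ hM (nonsing_inv_mul M (Ne.isUnit hM)) f
  map_add' f g := by
    apply Lp.ext
    have h1 := (quasiMeasurePreserving_toEuclideanLin M hM).ae (Lp.coeFn_add f g)
    filter_upwards [coeFn_UFun M hM (f + g), coeFn_UFun M hM f, coeFn_UFun M hM g,
      Lp.coeFn_add (UFun M hM f) (UFun M hM g), h1] with t a b c e h1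
    rw [a, e, h1, Pi.add_apply, Pi.add_apply, b, c, mul_add]
  map_smul' z f := by
    apply Lp.ext
    have h1 := (quasiMeasurePreserving_toEuclideanLin M hM).ae (Lp.coeFn_smul z f)
    filter_upwards [coeFn_UFun M hM (z • f), coeFn_UFun M hM f,
      Lp.coeFn_smul z (UFun M hM f), h1] with t a b e h1
    simp only [RingHom.id_apply]
    rw [a, e, h1, Pi.smul_apply, Pi.smul_apply, b, smul_eq_mul, smul_eq_mul]
    ring
  norm_map' f := by
    show ‖UFun M hM f‖ = ‖f‖
    rw [Lp.norm_def, Lp.norm_def, eLpNorm_congr_ae (coeFn_UFun M hM f),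
      eLpNorm_comp_toEuclideanLin M hM (Lp.memLp f).1]

/-- The translation operator `(T_ℓ f)(t) = f(t - ℓ)` for `ℓ ∈ ℤ^d`. -/
def T (ℓ : Fin d → ℤ) : L2 d →ₗᵢ[ℂ] L2 d :=
  Lp.compMeasurePreservingₗᵢ ℂ (fun t : Rd d => t - WithLp.toLp 2 fun i => (ℓ i : ℝ))
    (measurePreserving_sub_right volume _)

theorem det_realMat (A : Matrix (Fin d) (Fin d) ℤ) : (realMat A).det = (A.det : ℝ) :=
  (Int.cast_det A).symm

/-- The dilation operator `D_A = U_A` associated with an integral matrix of determinant `±2`. -/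
def D (A : Matrix (Fin d) (Fin d) ℤ) (hA : |A.det| = 2) : L2 d ≃ₗᵢ[ℂ] L2 d :=
  U (realMat A) (by
    rw [det_realMat, Int.cast_ne_zero]
    intro h
    simp [h] at hA)

/-- The unitary Fourier transform on `L²(ℝ^d)` normalized as
`(ℱ f)(s) = (2π)^{-d/2} ∫ e^{-i s∘t} f(t) dt` for `f ∈ L¹ ∩ L²`. Mathlib's transform is
`(𝓕 f)(s) = ∫ e^{-2π i s∘t} f(t) dt`, so that `(ℱ f)(s) = (2π)^{-d/2} (𝓕 f)(s / 2π)`. -/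
def fourier (d : ℕ) : L2 d ≃ₗᵢ[ℂ] L2 d :=
  (Lp.fourierTransformₗᵢ (Rd d) ℂ).trans
    (U ((2 * Real.pi)⁻¹ • (1 : Matrix (Fin d) (Fin d) ℝ)) (by
      rw [det_smul, det_one, mul_one]
      exact pow_ne_zero _ (inv_ne_zero (by positivity))))

end UnitaryOperators

open Classical in
/-- The scaling function `φ = ℱ⁻¹ g`. (The value `0` is a placeholder for the case `g ∉ L²`, which
does not occur under the standing assumptions.) -/
def scalingFun {d : ℕ} (A : Matrix (Fin d) (Fin d) ℤ) (h : (Fin d → ℤ) →₀ ℂ) : L2 d :=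
  if hg : MemLp (gFun A h) 2 (volume : Measure (Rd d)) then (fourier d).symm (hg.toLp _) else 0

/-- The coefficient `⟨f, D_A^J T_ℓ φ⟩` (Mathlib's inner product is linear in its second slot). -/
def coeff {d : ℕ} (A : Matrix (Fin d) (Fin d) ℤ) (hA : |A.det| = 2) (h : (Fin d → ℤ) →₀ ℂ)
    (J : ℤ) (f : L2 d) (ℓ : Fin d → ℤ) : ℂ :=
  inner ℂ ((D A hA ^ J) (T ℓ (scalingFun A h))) f

/-- `L_J(f) = ∑_ℓ |⟨f, D_A^J T_ℓ φ⟩|²`. -/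
def LJ {d : ℕ} (A : Matrix (Fin d) (Fin d) ℤ) (hA : |A.det| = 2) (h : (Fin d → ℤ) →₀ ℂ)
    (J : ℤ) (f : L2 d) : ℝ :=
  ∑' ℓ : Fin d → ℤ, ‖coeff A hA h J f ℓ‖ ^ 2

end ParsevalWavelet

end

/-!
Work on the Fourier side with characters of period `1`: there `φ` becomes the infinite product
`G(s) = ∏_{j ≥ 1} m₀(2π (Aᵀ)⁻ʲ s)`, which converges because `m₀` is Lipschitz with `m₀(0) = 1` and
the powers of `A⁻¹` are summable in norm.

Multiplying `G` by a trigonometric polynomial and truncating the product after `n` factors gives,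
up to a dilation, a trigonometric polynomial on the unit cube whose coefficients come from `n` steps
of the subdivision operator `x ↦ ∑ₘ xₘ h_{· - Am}`. Lawton's equations make that operator an
isometry of `ℓ²`, so by Fatou's lemma `G ∈ L²` and the synthesis map `x ↦ ∑_ℓ x_ℓ T_ℓ φ` has norm at
most `1`. Hence `L_J(f) ≤ ‖f‖²`, the functions `f ↦ √L_J(f)` are all `1`-Lipschitz, and it suffices
to compute their limits on dense sets.

If `𝓕 f` has bounded support, then for large `J` the support of `𝓕 (D_A^{-J} f)` lies in a small
ball around `0`, inside the unit cube and where `G` is close to `1`; Parseval's identity on the cube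
gives `√L_J(f) → ‖f‖`. If `f` itself has bounded support, then for `J → -∞` the support of
`D_A^{-J} f` shrinks to `0` and Cauchy–Schwarz bounds `L_J(f)` by `‖f‖²` times the mass of `φ` in
small balls around the lattice points, which tends to `0`.
-/

noncomputable section

namespace ParsevalWavelet

open MeasureTheory Matrix
open scoped FourierTransform ENNReal Matrix.Norms.L2Operator

/-! ### Decay of the powers of an inverse expansive matrix -/

section PowerDecay

theorem summable_norm_pow_of_spectralRadius_lt_one {R : Type*} [NormedRing R] [NormedAlgebra ℂ R]
    [CompleteSpace R] {a : R} (ha : spectralRadius ℂ a < 1) : Summable fun n : ℕ => ‖a ^ n‖ := by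
  obtain ⟨r, har, hr⟩ := ENNReal.lt_iff_exists_nnreal_btwn.mp ha
  have hr1 : (r : ℝ) < 1 := by exact_mod_cast hr
  have hroot : ∀ᶠ n : ℕ in Filter.atTop, (‖a ^ n‖₊ : ℝ≥0∞) ^ (1 / n : ℝ) < r :=
    (spectrum.pow_nnnorm_pow_one_div_tendsto_nhds_spectralRadius a).eventually_lt_const har
  refine Summable.of_norm_bounded_eventually_nat
    (summable_geometric_of_lt_one r.coe_nonneg hr1) ?_
  filter_upwards [hroot, Filter.eventually_gt_atTop 0] with n hn hn0
  have hpow : ((‖a ^ n‖₊ : ℝ≥0∞) ^ (1 / n : ℝ)) ^ n ≤ (r : ℝ≥0∞) ^ n := by gcongr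
  rw [← ENNReal.rpow_mul_natCast, one_div_mul_cancel (by positivity), ENNReal.rpow_one] at hpow
  rw [norm_norm]
  exact_mod_cast hpow

theorem spectralRadius_units_inv_lt_one {R : Type*} [NormedRing R] [NormedAlgebra ℂ R]
    [CompleteSpace R] {u : Rˣ} (hu : ∀ z ∈ spectrum ℂ (u : R), 1 < ‖z‖) :
    spectralRadius ℂ (↑u⁻¹ : R) < 1 := by
  rcases subsingleton_or_nontrivial R with _ | _
  · simp
  · refine spectrum.spectralRadius_lt_of_forall_lt (r := 1) _ fun z hz => ?_
    have hz0 : z ≠ 0 := spectrum.ne_zero_of_mem_of_unit hz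
    have hinv : 1 < ‖z⁻¹‖ := hu z⁻¹ (by
      simpa using (spectrum.inv_mem_iff (r := Units.mk0 z hz0) (a := u⁻¹)).mp hz)
    rw [norm_inv, one_lt_inv₀ (norm_pos_iff.mpr hz0)] at hinv
    exact_mod_cast hinv

theorem norm_le_norm_map_ofReal {m n : Type*} [Fintype m] [Fintype n] [DecidableEq n]
    (M : Matrix m n ℝ) : ‖M‖ ≤ ‖M.map Complex.ofRealHom‖ := by
  refine ContinuousLinearMap.opNorm_le_bound _ (norm_nonneg _) fun x => ?_
  have hx := l2_opNorm_mulVec (M.map Complex.ofRealHom) (WithLp.toLp 2 (Complex.ofRealHom ∘ x))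
  have hmul : M.map Complex.ofRealHom *ᵥ (Complex.ofRealHom ∘ x) = Complex.ofRealHom ∘ (M *ᵥ x) :=
    funext fun i => (RingHom.map_mulVec Complex.ofRealHom M x i).symm
  simp only [hmul] at hx
  simpa [EuclideanSpace.norm_eq, toLpLin_apply] using hx

variable {d : ℕ} {A : Matrix (Fin d) (Fin d) ℤ}

theorem map_ofReal_realMat (A : Matrix (Fin d) (Fin d) ℤ) :
    (realMat A).map Complex.ofRealHom = A.map (Int.cast : ℤ → ℂ) := by
  ext i j
  simp [realMat]

theorem IsExpansive.isUnit (hA : IsExpansive A) : IsUnit (A.map (Int.cast : ℤ → ℂ)) := by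
  by_contra h
  have hlt : 1 < ‖(0 : ℂ)‖ := hA 0 (spectrum.zero_mem ℂ h)
  norm_num at hlt

theorem IsExpansive.det_realMat_ne_zero (hA : IsExpansive A) : (realMat A).det ≠ 0 := by
  have h := (isUnit_iff_isUnit_det _).mp hA.isUnit
  rw [← map_ofReal_realMat, ← RingHom.mapMatrix_apply, ← RingHom.map_det] at h
  simpa using h.ne_zero

theorem IsExpansive.summable_norm_inv_pow (hA : IsExpansive A) :
    Summable fun n : ℕ => ‖(realMat A)⁻¹ ^ n‖ := by
  obtain ⟨u, hu⟩ := hA.isUnit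
  have : CompleteSpace (Matrix (Fin d) (Fin d) ℂ) := FiniteDimensional.complete ℂ _
  have hinv : (realMat A)⁻¹.map Complex.ofRealHom = ↑u⁻¹ := by
    rw [coe_units_inv, hu, ← map_ofReal_realMat]
    refine (inv_eq_left_inv ?_).symm
    rw [← Matrix.map_mul, nonsing_inv_mul _ hA.det_realMat_ne_zero.isUnit,
      Matrix.map_one _ (map_zero _) (map_one _)]
  have hsum : Summable fun n : ℕ => ‖(↑u⁻¹ : Matrix (Fin d) (Fin d) ℂ) ^ n‖ :=
    summable_norm_pow_of_spectralRadius_lt_one (spectralRadius_units_inv_lt_one (hu ▸ hA))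
  refine hsum.of_nonneg_of_le (fun _ => norm_nonneg _) fun n => ?_
  rw [← hinv, ← RingHom.mapMatrix_apply, ← map_pow]
  exact norm_le_norm_map_ofReal _

theorem IsExpansive.summable_norm_transpose_inv_pow (hA : IsExpansive A) :
    Summable fun n : ℕ => ‖(realMat A)ᵀ⁻¹ ^ n‖ := by
  refine hA.summable_norm_inv_pow.congr fun n => ?_
  rw [← l2_opNorm_conjTranspose, conjTranspose_eq_transpose_of_trivial, transpose_pow,
    transpose_nonsing_inv]

theorem norm_toEuclideanLin_le (M : Matrix (Fin d) (Fin d) ℝ) (x : Rd d) :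
    ‖toEuclideanLin M x‖ ≤ ‖M‖ * ‖x‖ :=
  l2_opNorm_mulVec M x

end PowerDecay

/-! ### Trigonometric polynomials and the subdivision operator -/

section TrigPoly

variable {d : ℕ}

/-- The lattice point `n ∈ ℤ^d` as a vector of `ℝ^d`. -/
def intVec (n : Fin d → ℤ) : Rd d :=
  WithLp.toLp 2 fun i => (n i : ℝ)

/-- The character `e^{-2πi n∘s}` of `ℝ^d / ℤ^d`. Period `1` rather than the paper's `2π` is the
normalization of Mathlib's Fourier transform. -/
def latticeChar (n : Fin d → ℤ) (s : Rd d) : ℂ :=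
  Real.fourierChar (-inner ℝ (intVec n) s)

/-- The trigonometric polynomial `∑ₙ xₙ e^{-2πi n∘s}`. -/
def trigPoly (x : (Fin d → ℤ) →₀ ℂ) (s : Rd d) : ℂ :=
  Finsupp.linearCombination ℂ (fun n => latticeChar n s) x

/-- The filter function with period `1`: `lowpass h s` is `m₀(2πs)`. -/
def lowpass (h : (Fin d → ℤ) →₀ ℂ) (s : Rd d) : ℂ :=
  (1 / (√2 : ℂ)) * trigPoly h s

theorem intVec_add (m n : Fin d → ℤ) : intVec (m + n) = intVec m + intVec n := by
  ext i
  simp [intVec]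

theorem intVec_mulVec (A : Matrix (Fin d) (Fin d) ℤ) (n : Fin d → ℤ) :
    intVec (A *ᵥ n) = toEuclideanLin (realMat A) (intVec n) := by
  ext i
  simp [intVec, realMat, toLpLin_apply, mulVec, dotProduct]

theorem inner_toEuclideanLin_transpose (M : Matrix (Fin d) (Fin d) ℝ) (s t : Rd d) :
    inner ℝ s (toEuclideanLin Mᵀ t) = inner ℝ (toEuclideanLin M s) t := by
  rw [← conjTranspose_eq_transpose_of_trivial, toEuclideanLin_conjTranspose_eq_adjoint,
    LinearMap.adjoint_inner_right]

@[simp]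
theorem norm_latticeChar (n : Fin d → ℤ) (s : Rd d) : ‖latticeChar n s‖ = 1 :=
  Circle.norm_coe _

theorem latticeChar_zero_right (n : Fin d → ℤ) : latticeChar n (0 : Rd d) = 1 := by
  simp [latticeChar]

theorem latticeChar_add (m n : Fin d → ℤ) (s : Rd d) :
    latticeChar (m + n) s = latticeChar m s * latticeChar n s := by
  simp only [latticeChar, intVec_add, inner_add_left, neg_add, AddChar.map_add_eq_mul,
    Circle.coe_mul]

theorem latticeChar_mulVec (A : Matrix (Fin d) (Fin d) ℤ) (n : Fin d → ℤ) (s : Rd d) :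
    latticeChar (A *ᵥ n) s = latticeChar n (toEuclideanLin (realMat A)ᵀ s) := by
  rw [latticeChar, latticeChar, intVec_mulVec, inner_toEuclideanLin_transpose]

@[fun_prop]
theorem continuous_latticeChar (n : Fin d → ℤ) : Continuous (latticeChar n) := by
  unfold latticeChar
  fun_prop

theorem norm_latticeChar_sub_one_le (n : Fin d → ℤ) (s : Rd d) :
    ‖latticeChar n s - 1‖ ≤ 2 * Real.pi * ‖intVec n‖ * ‖s‖ := by
  have hexp : ‖latticeChar n s - 1‖ ≤ ‖2 * Real.pi * -inner ℝ (intVec n) s‖ := by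
    rw [latticeChar, Real.fourierChar_apply, mul_comm]
    exact Real.norm_exp_I_mul_ofReal_sub_one_le
  refine hexp.trans ?_
  rw [norm_mul, norm_neg, Real.norm_of_nonneg Real.two_pi_pos.le, mul_assoc _ ‖intVec n‖]
  gcongr
  exact norm_inner_le_norm _ _

@[fun_prop]
theorem continuous_trigPoly (x : (Fin d → ℤ) →₀ ℂ) : Continuous (trigPoly x) := by
  unfold trigPoly
  simp only [Finsupp.linearCombination_apply, Finsupp.sum]
  fun_prop

@[fun_prop]
theorem continuous_lowpass (h : (Fin d → ℤ) →₀ ℂ) : Continuous (lowpass h) := by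
  unfold lowpass
  fun_prop

theorem trigPoly_zero_right (x : (Fin d → ℤ) →₀ ℂ) : trigPoly x 0 = x.sum fun _ c => c := by
  simp [trigPoly, Finsupp.linearCombination_apply, latticeChar_zero_right]

theorem exists_norm_trigPoly_sub_le (x : (Fin d → ℤ) →₀ ℂ) :
    ∃ K : ℝ, ∀ s, ‖trigPoly x s - trigPoly x 0‖ ≤ K * ‖s‖ := by
  induction x using Finsupp.induction_linear with
  | zero => exact ⟨0, by simp [trigPoly]⟩
  | add x y hx hy =>
    obtain ⟨K, hK⟩ := hx
    obtain ⟨L, hL⟩ := hy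
    refine ⟨K + L, fun s => ?_⟩
    simp only [trigPoly, map_add] at hK hL ⊢
    rw [add_sub_add_comm, add_mul]
    exact norm_add_le_of_le (hK s) (hL s)
  | single n c =>
    refine ⟨‖c‖ * (2 * Real.pi * ‖intVec n‖), fun s => ?_⟩
    simp only [trigPoly, Finsupp.linearCombination_single, latticeChar_zero_right, ← smul_sub,
      norm_smul, mul_assoc ‖c‖]
    gcongr
    exact norm_latticeChar_sub_one_le n s

theorem exists_norm_lowpass_sub_one_le {h : (Fin d → ℤ) →₀ ℂ} (h0 : lowpass h 0 = 1) :
    ∃ K : ℝ, 0 ≤ K ∧ ∀ s, ‖lowpass h s - 1‖ ≤ K * ‖s‖ := by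
  obtain ⟨K, hK⟩ := exists_norm_trigPoly_sub_le h
  refine ⟨‖(1 / (√2 : ℂ))‖ * |K|, by positivity, fun s => ?_⟩
  have hsub : lowpass h s - 1 = (1 / (√2 : ℂ)) * (trigPoly h s - trigPoly h 0) := by
    rw [mul_sub, ← lowpass, ← lowpass, h0]
  rw [hsub, norm_mul, mul_assoc]
  gcongr
  exact (hK s).trans (by gcongr; exact le_abs_self K)

theorem IsLawtonSolution.lowpass_zero {A : Matrix (Fin d) (Fin d) ℤ} {h : (Fin d → ℤ) →₀ ℂ}
    (hh : IsLawtonSolution A h) : lowpass h 0 = 1 := by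
  rw [lowpass, trigPoly_zero_right, hh.2, one_div, inv_mul_cancel₀ (by simp)]

theorem filterFun_two_pi_smul (h : (Fin d → ℤ) →₀ ℂ) (s : Rd d) :
    filterFun h ((2 * Real.pi) • s) = lowpass h s := by
  simp only [filterFun, lowpass, trigPoly, Finsupp.linearCombination_apply, Finsupp.sum,
    smul_eq_mul, latticeChar, Real.fourierChar_apply]
  congr! 4 with n
  have hinner : inner ℝ (intVec n) s = ∑ i, (n i : ℝ) * s i := by
    simp [intVec, PiLp.inner_apply, mul_comm]
  simp only [hinner, PiLp.smul_apply, smul_eq_mul, mul_left_comm _ (2 * Real.pi), ← Finset.mul_sum]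
  push_cast
  ring

end TrigPoly

section Subdivision

variable {d : ℕ}

/-- The subdivision operator of the filter `h`: `(S x)ₖ = ∑ₘ xₘ h_{k - A m}`. -/
def subdiv (A : Matrix (Fin d) (Fin d) ℤ) (h x : (Fin d → ℤ) →₀ ℂ) : (Fin d → ℤ) →₀ ℂ :=
  Finsupp.linearCombination ℂ (fun m => h.mapDomain fun n => n + A *ᵥ m) x

variable {A : Matrix (Fin d) (Fin d) ℤ} {h : (Fin d → ℤ) →₀ ℂ}

theorem linearCombination_subdiv {V : Type*} [AddCommGroup V] [Module ℂ V]
    (A : Matrix (Fin d) (Fin d) ℤ) (h x : (Fin d → ℤ) →₀ ℂ) (v : (Fin d → ℤ) → V) :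
    Finsupp.linearCombination ℂ v (subdiv A h x) =
      Finsupp.linearCombination ℂ
        (fun m => Finsupp.linearCombination ℂ v (h.mapDomain fun n => n + A *ᵥ m)) x := by
  simp only [subdiv, Finsupp.linearCombination_apply ℂ x, Finsupp.sum, map_sum, map_smul]

theorem trigPoly_mapDomain_add (x : (Fin d → ℤ) →₀ ℂ) (k : Fin d → ℤ) (s : Rd d) :
    trigPoly (x.mapDomain (· + k)) s = latticeChar k s * trigPoly x s := by
  simp only [trigPoly, Finsupp.linearCombination_mapDomain]
  simp only [Finsupp.linearCombination_apply, Finsupp.sum, Finset.mul_sum, Function.comp_apply,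
    latticeChar_add, smul_eq_mul]
  exact Finset.sum_congr rfl fun n _ => by ring

theorem trigPoly_subdiv (A : Matrix (Fin d) (Fin d) ℤ) (h x : (Fin d → ℤ) →₀ ℂ) (s : Rd d) :
    trigPoly (subdiv A h x) s = trigPoly x (toEuclideanLin (realMat A)ᵀ s) * trigPoly h s := by
  rw [trigPoly, linearCombination_subdiv]
  change Finsupp.linearCombination ℂ (fun m => trigPoly (h.mapDomain (· + A *ᵥ m)) s) x = _
  simp only [trigPoly_mapDomain_add, latticeChar_mulVec]
  simp only [trigPoly, Finsupp.linearCombination_apply, Finsupp.sum, Finset.sum_mul,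
    smul_eq_mul, mul_assoc]

theorem toEuclideanLin_pow_succ_apply (M : Matrix (Fin d) (Fin d) ℝ) (n : ℕ) (s : Rd d) :
    toEuclideanLin (M ^ (n + 1)) s = toEuclideanLin M (toEuclideanLin (M ^ n) s) := by
  rw [pow_succ', toLpLin_mul_same, LinearMap.comp_apply]

theorem toEuclideanLin_inv_apply {M : Matrix (Fin d) (Fin d) ℝ} (hM : M.det ≠ 0) (s : Rd d) :
    toEuclideanLin M (toEuclideanLin M⁻¹ s) = s := by
  rw [← LinearMap.comp_apply, ← toLpLin_mul_same, mul_nonsing_inv _ hM.isUnit, toLpLin_one,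
    LinearMap.id_apply]

theorem trigPoly_iterate_subdiv (hA : (realMat A).det ≠ 0) (x : (Fin d → ℤ) →₀ ℂ) (n : ℕ)
    (s : Rd d) :
    trigPoly ((subdiv A h)^[n] x) (toEuclideanLin ((realMat A)ᵀ⁻¹ ^ n) s) =
      trigPoly x s *
        ∏ j ∈ Finset.range n, trigPoly h (toEuclideanLin ((realMat A)ᵀ⁻¹ ^ (j + 1)) s) := by
  induction n with
  | zero => simp
  | succ n ih =>
    rw [Function.iterate_succ_apply', trigPoly_subdiv, Finset.prod_range_succ, ← mul_assoc, ← ih,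
      toEuclideanLin_pow_succ_apply, toEuclideanLin_inv_apply (by rwa [det_transpose])]

theorem orthonormal_linearCombination_shift {H : Type*} [NormedAddCommGroup H]
    [InnerProductSpace ℂ H] {v : (Fin d → ℤ) → H} (hv : Orthonormal ℂ v) (hA : A.det ≠ 0)
    (hh : IsLawtonSolution A h) :
    Orthonormal ℂ fun m => Finsupp.linearCombination ℂ v (h.mapDomain (· + A *ᵥ m)) := by
  classical
  refine orthonormal_iff_ite.mpr fun m m' => ?_
  have hshift : ∀ n, h.mapDomain (· + A *ᵥ m') (n + A *ᵥ m) = h (n + A *ᵥ (m - m')) := fun n => by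
    rw [← Finsupp.mapDomain_apply (add_left_injective (A *ᵥ m')) h, mulVec_sub, add_assoc,
      sub_add_cancel]
  have hlawton := congrArg (starRingEnd ℂ) (hh.1 (A *ᵥ (m - m')) ⟨_, rfl⟩)
  simp only [Finsupp.sum, map_sum, map_mul, Complex.conj_conj] at hlawton
  have hzero : A *ᵥ (m - m') = 0 ↔ m = m' :=
    ⟨fun h => sub_eq_zero.mp (eq_zero_of_mulVec_eq_zero hA h), fun h => by simp [h]⟩
  rw [hv.inner_finsupp_eq_sum_left, Finsupp.sum_mapDomain_index_inj (add_left_injective _)]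
  simp only [hshift, Finsupp.sum, hlawton, hzero]
  split_ifs <;> simp

theorem norm_sq_linearCombination_of_orthonormal {𝕜 ι H : Type*} [RCLike 𝕜] [NormedAddCommGroup H]
    [InnerProductSpace 𝕜 H] {v : ι → H} (hv : Orthonormal 𝕜 v) (x : ι →₀ 𝕜) :
    ‖Finsupp.linearCombination 𝕜 v x‖ ^ 2 = x.sum fun _ c => ‖c‖ ^ 2 := by
  rw [← RCLike.ofReal_inj (K := 𝕜), RCLike.ofReal_pow, ← inner_self_eq_norm_sq_to_K,
    hv.inner_finsupp_eq_sum_left, Finsupp.sum, Finsupp.sum, RCLike.ofReal_sum]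
  exact Finset.sum_congr rfl fun i _ => by simp [RCLike.conj_mul]

theorem sum_norm_sq_iterate_subdiv (hA : A.det ≠ 0) (hh : IsLawtonSolution A h)
    (x : (Fin d → ℤ) →₀ ℂ) (n : ℕ) :
    (((subdiv A h)^[n] x).sum fun _ c => ‖c‖ ^ 2) = x.sum fun _ c => ‖c‖ ^ 2 := by
  induction n with
  | zero => rfl
  | succ n ih =>
    have hv := UnitAddTorus.orthonormal_mFourier (d := Fin d)
    rw [Function.iterate_succ_apply', ← ih, ← norm_sq_linearCombination_of_orthonormal hv,
      linearCombination_subdiv, norm_sq_linearCombination_of_orthonormal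
        (orthonormal_linearCombination_shift hv hA hh)]

end Subdivision

/-! ### Parseval's identity on the unit cube -/

section Cube

variable {d : ℕ}

/-- The normalized Haar measure on `ℝ / ℤ`, as in the theory of multivariate Fourier series. -/
local instance : MeasureSpace UnitAddCircle := ⟨AddCircle.haarAddCircle⟩

local instance : IsProbabilityMeasure (volume : Measure UnitAddCircle) :=
  inferInstanceAs (IsProbabilityMeasure AddCircle.haarAddCircle)

/-- The half-open unit cube centred at the origin, a fundamental domain of `ℝ^d / ℤ^d`. -/
def cube (d : ℕ) : Set (Rd d) :=
  {s | ∀ i, s i ∈ Set.Ioc (-1 / 2 : ℝ) (-1 / 2 + 1)}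

theorem measurableSet_cube : MeasurableSet (cube d) := by
  simp only [cube, Set.ofPred_forall]
  exact MeasurableSet.iInter fun i => measurableSet_Ioc.preimage (by fun_prop)

theorem ball_subset_cube : Metric.ball 0 (1 / 2) ⊆ cube d := by
  intro s hs i
  have hi := (PiLp.norm_apply_le s i).trans_lt (mem_ball_zero_iff.mp hs)
  rw [Real.norm_eq_abs, abs_lt] at hi
  exact ⟨by linarith [hi.1], by linarith [hi.2]⟩

/-- The section of the covering `ℝ^d → (ℝ/ℤ)^d` with values in the unit cube. -/
def cubeSection (y : UnitAddTorus (Fin d)) : Rd d :=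
  WithLp.toLp 2 (UnitAddTorus.measurableEquivPiIoc (fun _ => (-1 / 2 : ℝ)) y).1

theorem measurableSet_piIoc :
    MeasurableSet {x : Fin d → ℝ | ∀ i, x i ∈ Set.Ioc (-1 / 2 : ℝ) (-1 / 2 + 1)} :=
  MeasurableSet.univ_pi' fun _ => measurableSet_Ioc

theorem measurableEmbedding_cubeSection : MeasurableEmbedding (cubeSection (d := d)) :=
  (MeasurableEquiv.toLp 2 (Fin d → ℝ)).measurableEmbedding.comp
    ((MeasurableEmbedding.subtype_coe measurableSet_piIoc).comp
      (UnitAddTorus.measurableEquivPiIoc fun _ => (-1 / 2 : ℝ)).measurableEmbedding)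

theorem measurePreserving_cubeSection :
    MeasurePreserving (cubeSection (d := d)) volume (volume.restrict (cube d)) := by
  have hequiv := UnitAddTorus.measurePreserving_equivPiIoc fun _ : Fin d => (-1 / 2 : ℝ)
  have hval : MeasurePreserving
      (Subtype.val : {x : Fin d → ℝ // ∀ i, x i ∈ Set.Ioc (-1 / 2 : ℝ) (-1 / 2 + 1)} → _)
      (Measure.comap Subtype.val volume)
      (volume.restrict {x : Fin d → ℝ | ∀ i, x i ∈ Set.Ioc (-1 / 2 : ℝ) (-1 / 2 + 1)}) :=
    ⟨measurable_subtype_coe, map_comap_subtype_coe measurableSet_piIoc volume⟩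
  have hcube := (EuclideanSpace.volume_preserving_symm_measurableEquiv_toLp (Fin d)).symm
    |>.restrict_preimage (measurableSet_cube (d := d))
  exact hcube.comp (hval.comp hequiv)

theorem mFourier_neg_eq_latticeChar (n : Fin d → ℤ) (y : UnitAddTorus (Fin d)) :
    UnitAddTorus.mFourier (-n) y = latticeChar n (cubeSection y) := by
  have hy : ∀ i, y i = ((cubeSection y i : ℝ) : UnitAddCircle) := fun i =>
    ((AddCircle.equivIoc (1 : ℝ) (-1 / 2)).symm_apply_apply (y i)).symm
  simp only [UnitAddTorus.mFourier, ContinuousMap.coe_mk, latticeChar, Real.fourierChar_apply]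
  rw [Finset.prod_congr rfl fun i _ => by rw [hy i, fourier_coe_apply], ← Complex.exp_sum]
  simp only [intVec, PiLp.inner_apply, RCLike.inner_apply, conj_trivial, Pi.neg_apply]
  push_cast
  rw [mul_neg, neg_mul, Finset.mul_sum, Finset.sum_mul, ← Finset.sum_neg_distrib]
  congr! 2 with i
  ring

theorem hasSum_norm_sq_integral_latticeChar {u : Rd d → ℂ}
    (hu : MemLp u 2 (volume.restrict (cube d))) :
    HasSum (fun n : Fin d → ℤ => ‖∫ s in cube d, latticeChar n s * u s‖ ^ 2)
      (∫ s in cube d, ‖u s‖ ^ 2) := by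
  have hv := hu.comp_measurePreserving measurePreserving_cubeSection
  simp only [← measurePreserving_cubeSection.integral_comp measurableEmbedding_cubeSection]
  have hnorm : ∫ y, ‖hv.toLp _ y‖ ^ 2 = ∫ y, ‖u (cubeSection y)‖ ^ 2 :=
    integral_congr_ae (hv.coeFn_toLp.fun_comp (‖·‖ ^ 2))
  rw [← hnorm]
  refine (UnitAddTorus.hasSum_sq_mFourierCoeff (hv.toLp _)).congr_fun fun n => ?_
  rw [UnitAddTorus.mFourierCoeff]
  congr 2
  refine integral_congr_ae ?_
  filter_upwards [hv.coeFn_toLp] with y hy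
  rw [hy, Function.comp_apply, mFourier_neg_eq_latticeChar, smul_eq_mul]

theorem eLpNorm_trigPoly_restrict_cube (x : (Fin d → ℤ) →₀ ℂ) :
    eLpNorm (trigPoly x) 2 (volume.restrict (cube d)) =
      ENNReal.ofReal (√(x.sum fun _ c => ‖c‖ ^ 2)) := by
  have hv : Orthonormal ℂ fun n : Fin d → ℤ => UnitAddTorus.mFourierLp 2 (-n) :=
    UnitAddTorus.orthonormal_mFourier.comp _ neg_injective
  set F : C(UnitAddTorus (Fin d), ℂ) :=
    Finsupp.linearCombination ℂ (fun n => UnitAddTorus.mFourier (-n)) x with hF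
  have hFLp : Finsupp.linearCombination ℂ (fun n : Fin d → ℤ => UnitAddTorus.mFourierLp 2 (-n)) x =
      ContinuousMap.toLp (E := ℂ) 2 volume ℂ F := by
    simp [hF, Finsupp.linearCombination_apply, Finsupp.sum, map_sum]
  have hFtrig : ⇑F = trigPoly x ∘ cubeSection := by
    ext y
    simp [hF, trigPoly, Finsupp.linearCombination_apply, Finsupp.sum, mFourier_neg_eq_latticeChar]
  rw [← norm_sq_linearCombination_of_orthonormal hv, Real.sqrt_sq (norm_nonneg _), hFLp,
    ofReal_norm, Lp.enorm_def, eLpNorm_congr_ae (ContinuousMap.coeFn_toLp volume F), hFtrig,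
    eLpNorm_comp_measurePreserving (continuous_trigPoly x).aestronglyMeasurable
      measurePreserving_cubeSection]

end Cube

/-! ### The infinite product -/

section InfiniteProduct

variable {ι R : Type*} [NormedCommRing R] [NormOneClass R] [CompleteSpace R] {f : ι → R}

theorem multipliable_of_summable_norm_sub_one (hf : Summable fun i => ‖f i - 1‖) :
    Multipliable f := by
  simpa only [add_sub_cancel] using multipliable_one_add_of_summable hf

theorem norm_tprod_sub_one_le (hf : Summable fun i => ‖f i - 1‖) :
    ‖∏' i, f i - 1‖ ≤ Real.exp (∑' i, ‖f i - 1‖) - 1 := by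
  refine le_of_tendsto
    ((multipliable_of_summable_norm_sub_one hf).hasProd.sub_const 1).norm (.of_forall fun t => ?_)
  have hprod := t.norm_prod_one_add_sub_one_le fun i => f i - 1
  simp only [add_sub_cancel] at hprod
  refine hprod.trans (sub_le_sub_right (Real.exp_le_exp.mpr ?_) _)
  exact hf.sum_le_tsum t fun _ _ => norm_nonneg _

end InfiniteProduct

section Symbol

variable {d : ℕ} {A : Matrix (Fin d) (Fin d) ℤ} {h : (Fin d → ℤ) →₀ ℂ}

/-- The infinite product `∏_{j ≥ 1} m₀((Aᵀ)^{-j} ξ)` at `ξ = 2πs`. -/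
def symbol (A : Matrix (Fin d) (Fin d) ℤ) (h : (Fin d → ℤ) →₀ ℂ) (s : Rd d) : ℂ :=
  ∏' j : ℕ, lowpass h (toEuclideanLin ((realMat A)ᵀ⁻¹ ^ (j + 1)) s)

theorem exists_tsum_norm_lowpass_sub_one_le (hA : IsExpansive A) (h0 : lowpass h 0 = 1) :
    ∃ K : ℝ, ∀ s : Rd d,
      Summable (fun j : ℕ => ‖lowpass h (toEuclideanLin ((realMat A)ᵀ⁻¹ ^ (j + 1)) s) - 1‖) ∧
      ∑' j : ℕ, ‖lowpass h (toEuclideanLin ((realMat A)ᵀ⁻¹ ^ (j + 1)) s) - 1‖ ≤ K * ‖s‖ := by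
  obtain ⟨K, hK, hlip⟩ := exists_norm_lowpass_sub_one_le h0
  have hsum := ((summable_nat_add_iff 1).mpr hA.summable_norm_transpose_inv_pow).mul_left K
  refine ⟨∑' j : ℕ, K * ‖(realMat A)ᵀ⁻¹ ^ (j + 1)‖, fun s => ?_⟩
  have hle : ∀ j : ℕ, ‖lowpass h (toEuclideanLin ((realMat A)ᵀ⁻¹ ^ (j + 1)) s) - 1‖ ≤
      K * ‖(realMat A)ᵀ⁻¹ ^ (j + 1)‖ * ‖s‖ := fun j => by
    refine (hlip _).trans ?_
    rw [mul_assoc]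
    gcongr
    exact norm_toEuclideanLin_le _ s
  have hsum' := (hsum.mul_right ‖s‖).of_nonneg_of_le (fun _ => norm_nonneg _) hle
  exact ⟨hsum', (hsum'.tsum_le_tsum hle (hsum.mul_right ‖s‖)).trans_eq tsum_mul_right⟩

theorem multipliable_lowpass (hA : IsExpansive A) (h0 : lowpass h 0 = 1) (s : Rd d) :
    Multipliable fun j : ℕ => lowpass h (toEuclideanLin ((realMat A)ᵀ⁻¹ ^ (j + 1)) s) :=
  have ⟨_, hK⟩ := exists_tsum_norm_lowpass_sub_one_le hA h0
  multipliable_of_summable_norm_sub_one (hK s).1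

theorem tendsto_prod_lowpass (hA : IsExpansive A) (h0 : lowpass h 0 = 1) (s : Rd d) :
    Filter.Tendsto (fun n => ∏ j ∈ Finset.range n,
      lowpass h (toEuclideanLin ((realMat A)ᵀ⁻¹ ^ (j + 1)) s)) Filter.atTop
      (nhds (symbol A h s)) :=
  (multipliable_lowpass hA h0 s).tendsto_prod_tprod_nat

theorem tendsto_symbol_nhds_zero (hA : IsExpansive A) (h0 : lowpass h 0 = 1) :
    Filter.Tendsto (symbol A h) (nhds 0) (nhds 1) := by
  obtain ⟨K, hK⟩ := exists_tsum_norm_lowpass_sub_one_le hA h0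
  refine tendsto_iff_norm_sub_tendsto_zero.mpr (squeeze_zero (fun _ => norm_nonneg _)
    (fun s => (norm_tprod_sub_one_le (hK s).1).trans
      (sub_le_sub_right (Real.exp_le_exp.mpr (hK s).2) 1)) ?_)
  have hcont : Continuous fun s : Rd d => Real.exp (K * ‖s‖) - 1 := by fun_prop
  simpa using hcont.tendsto 0

theorem measurable_symbol (hA : IsExpansive A) (h0 : lowpass h 0 = 1) :
    Measurable (symbol A h) :=
  measurable_of_tendsto_metrizable
    (fun _ => Finset.measurable_prod _ fun _ _ =>
      (continuous_lowpass h).measurable.comp (measurable_toEuclideanLin _))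
    (tendsto_pi_nhds.mpr (tendsto_prod_lowpass hA h0))

end Symbol

section Truncation

variable {d : ℕ} {A : Matrix (Fin d) (Fin d) ℤ} {h : (Fin d → ℤ) →₀ ℂ}

/-- The truncation `x̂(s) ∏_{1 ≤ j ≤ n} m₀(2π (Aᵀ)^{-j} s)` of the infinite product to the dilated
cube `(Aᵀ)^n cube`, written through the `n`-th iterate of the subdivision operator. -/
def truncation (A : Matrix (Fin d) (Fin d) ℤ) (h x : (Fin d → ℤ) →₀ ℂ) (n : ℕ) (s : Rd d) : ℂ :=
  (√|((realMat A)ᵀ⁻¹ ^ n).det| : ℂ) *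
    (cube d).indicator (trigPoly ((subdiv A h)^[n] x)) (toEuclideanLin ((realMat A)ᵀ⁻¹ ^ n) s)

theorem IsExpansive.det_transpose_inv_pow_ne_zero (hA : IsExpansive A) (n : ℕ) :
    ((realMat A)ᵀ⁻¹ ^ n).det ≠ 0 := by
  simpa [det_nonsing_inv] using fun h => absurd h hA.det_realMat_ne_zero

theorem sqrt_abs_det_transpose_inv_pow (hA : |A.det| = 2) (n : ℕ) :
    √|((realMat A)ᵀ⁻¹ ^ n).det| = (1 / √2) ^ n := by
  rw [det_pow, det_nonsing_inv, det_transpose, det_realMat, abs_pow, Ring.inverse_eq_inv, abs_inv,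
    ← Int.cast_abs, hA, Real.sqrt_eq_iff_eq_sq (by positivity) (by positivity), ← pow_mul,
    mul_comm n, pow_mul]
  norm_num

theorem eLpNorm_truncation (hA : IsExpansive A) (hh : IsLawtonSolution A h)
    (x : (Fin d → ℤ) →₀ ℂ) (n : ℕ) :
    eLpNorm (truncation A h x n) 2 volume =
      ENNReal.ofReal (√(x.sum fun _ c => ‖c‖ ^ 2)) := by
  have hdet : A.det ≠ 0 := by simpa [det_realMat] using hA.det_realMat_ne_zero
  rw [← sum_norm_sq_iterate_subdiv hdet hh x n, ← eLpNorm_trigPoly_restrict_cube,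
    ← eLpNorm_indicator_eq_eLpNorm_restrict measurableSet_cube]
  exact eLpNorm_comp_toEuclideanLin _ (hA.det_transpose_inv_pow_ne_zero n)
    ((continuous_trigPoly _).aestronglyMeasurable.indicator measurableSet_cube)

theorem tendsto_toEuclideanLin_pow {M : Matrix (Fin d) (Fin d) ℝ}
    (hM : Filter.Tendsto (fun n : ℕ => ‖M ^ n‖) Filter.atTop (nhds 0)) (s : Rd d) :
    Filter.Tendsto (fun n : ℕ => toEuclideanLin (M ^ n) s) Filter.atTop (nhds 0) :=
  squeeze_zero_norm (fun _ => norm_toEuclideanLin_le _ s) (by simpa using hM.mul_const ‖s‖)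

theorem tendsto_truncation (hexp : IsExpansive A) (hA : |A.det| = 2) (h0 : lowpass h 0 = 1)
    (x : (Fin d → ℤ) →₀ ℂ) (s : Rd d) :
    Filter.Tendsto (fun n => truncation A h x n s) Filter.atTop
      (nhds (trigPoly x s * symbol A h s)) := by
  refine ((tendsto_prod_lowpass hexp h0 s).const_mul (trigPoly x s)).congr' ?_
  have hcube := (tendsto_toEuclideanLin_pow
    hexp.summable_norm_transpose_inv_pow.tendsto_atTop_zero s).eventually
      (Metric.ball_mem_nhds 0 one_half_pos)
  filter_upwards [hcube] with n hn
  rw [truncation, Set.indicator_of_mem (ball_subset_cube hn),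
    trigPoly_iterate_subdiv hexp.det_realMat_ne_zero, sqrt_abs_det_transpose_inv_pow hA]
  simp only [lowpass, Finset.prod_mul_distrib, Finset.prod_const, Finset.card_range]
  push_cast
  ring

theorem eLpNorm_trigPoly_mul_symbol_le (hexp : IsExpansive A) (hA : |A.det| = 2)
    (hh : IsLawtonSolution A h) (x : (Fin d → ℤ) →₀ ℂ) :
    eLpNorm (fun s => trigPoly x s * symbol A h s) 2 volume ≤
      ENNReal.ofReal (√(x.sum fun _ c => ‖c‖ ^ 2)) := by
  have hmeas : ∀ n, AEStronglyMeasurable (truncation A h x n) volume := fun n =>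
    ((((continuous_trigPoly _).measurable.indicator measurableSet_cube).comp
      (measurable_toEuclideanLin _)).const_mul _).aestronglyMeasurable
  have hfatou := Lp.eLpNorm_lim_le_liminf_eLpNorm (p := 2) hmeas _
    (.of_forall (tendsto_truncation hexp hA hh.lowpass_zero x))
  simpa only [eLpNorm_truncation hexp hh, Filter.liminf_const] using hfatou

theorem memLp_symbol (hexp : IsExpansive A) (hA : |A.det| = 2) (hh : IsLawtonSolution A h) :
    MemLp (symbol A h) 2 volume := by
  refine ⟨(measurable_symbol hexp hh.lowpass_zero).aestronglyMeasurable, ?_⟩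
  have hle := eLpNorm_trigPoly_mul_symbol_le hexp hA hh (Finsupp.single 0 1)
  simp only [trigPoly, Finsupp.linearCombination_single, one_smul] at hle
  refine lt_of_eq_of_lt (eLpNorm_congr_norm_ae (.of_forall fun s => ?_))
    (hle.trans_lt ENNReal.ofReal_lt_top)
  rw [norm_mul, norm_latticeChar, one_mul]

end Truncation

/-! ### Translations and dilations on the Fourier side -/

section FourierIntertwining

variable {d : ℕ}

theorem memLp_top_latticeChar (ℓ : Fin d → ℤ) : MemLp (latticeChar ℓ) ∞ (volume : Measure (Rd d)) :=
  memLp_top_of_bound (continuous_latticeChar ℓ).aestronglyMeasurable 1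
    (ae_of_all _ fun s => (norm_latticeChar ℓ s).le)

/-- Multiplication by the character `e^{-2πi ℓ∘s}` on `L²(ℝ^d)`, which is what the translation `T ℓ`
becomes on the Fourier side. -/
def modulation (ℓ : Fin d → ℤ) : L2 d →L[ℂ] L2 d :=
  (ContinuousLinearMap.mul ℂ ℂ).holderL volume ∞ 2 2 (memLp_top_latticeChar ℓ).toLp

theorem coeFn_modulation (ℓ : Fin d → ℤ) (f : L2 d) :
    (modulation ℓ f : Rd d → ℂ) =ᵐ[volume] fun s => latticeChar ℓ s * f s := by
  filter_upwards [(ContinuousLinearMap.mul ℂ ℂ).coeFn_holder (r := 2)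
    (memLp_top_latticeChar ℓ).toLp f, (memLp_top_latticeChar ℓ).coeFn_toLp] with s hs hχ
  rw [← hχ]
  exact hs

theorem coeFn_T (ℓ : Fin d → ℤ) (f : L2 d) :
    (T ℓ f : Rd d → ℂ) =ᵐ[volume] fun t => f (t - intVec ℓ) :=
  Lp.coeFn_compMeasurePreserving f (measurePreserving_sub_right volume (intVec ℓ))

theorem T_toLp (ℓ : Fin d → ℤ) (f : SchwartzMap (Rd d) ℂ) :
    T ℓ (f.toLp 2) = (f.compSubConstCLM ℝ (intVec ℓ)).toLp 2 := by
  apply Lp.ext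
  filter_upwards [coeFn_T ℓ (f.toLp 2), (f.compSubConstCLM ℝ (intVec ℓ)).coeFn_toLp 2,
    (measurePreserving_sub_right (volume : Measure (Rd d)) (intVec ℓ)).quasiMeasurePreserving.ae
      (f.coeFn_toLp 2 volume)] with t hT hf hsub
  rw [hT, hsub, hf, SchwartzMap.compSubConstCLM_apply]

theorem ext_toLp_schwartz {p : ℝ≥0∞} [Fact (1 ≤ p)] (hp : p ≠ ∞) {X : Type*} [TopologicalSpace X]
    [T2Space X] {F G : Lp (α := Rd d) ℂ p → X} (hF : Continuous F) (hG : Continuous G)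
    (h : ∀ f : SchwartzMap (Rd d) ℂ, F (f.toLp p) = G (f.toLp p)) : F = G :=
  (SchwartzMap.denseRange_toLpCLM hp).equalizer hF hG (funext h)

theorem fourier_T (ℓ : Fin d → ℤ) (f : L2 d) : 𝓕 (T ℓ f) = modulation ℓ (𝓕 f) := by
  refine congrFun (ext_toLp_schwartz (F := fun f : L2 d => 𝓕 (T ℓ f)) ENNReal.ofNat_ne_top
    ((Lp.fourierTransformₗᵢ (Rd d) ℂ).continuous.comp (T ℓ).continuous)
    ((modulation ℓ).continuous.comp (Lp.fourierTransformₗᵢ (Rd d) ℂ).continuous) fun f => ?_) f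
  change 𝓕 (T ℓ (f.toLp 2)) = modulation ℓ (𝓕 (f.toLp 2))
  rw [T_toLp, SchwartzMap.toLp_fourier_eq, SchwartzMap.toLp_fourier_eq]
  apply Lp.ext
  filter_upwards [coeFn_modulation ℓ ((𝓕 f).toLp 2), (𝓕 f).coeFn_toLp 2,
    (𝓕 (f.compSubConstCLM ℝ (intVec ℓ))).coeFn_toLp 2] with s hmod hf hsub
  rw [hmod, hf, hsub, SchwartzMap.fourier_coe, SchwartzMap.fourier_coe]
  have hshift := congrFun (VectorFourier.fourierIntegral_comp_add_right Real.fourierChar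
    (volume : Measure (Rd d)) (innerₗ (Rd d)) f (-intVec ℓ)) s
  rw [map_neg, LinearMap.neg_apply, innerₗ_apply_apply, Circle.smul_def, smul_eq_mul] at hshift
  have hcoe : ⇑(f.compSubConstCLM ℝ (intVec ℓ)) = f ∘ fun v => v + -intVec ℓ := by
    ext v
    rw [SchwartzMap.compSubConstCLM_apply, Function.comp_apply, sub_eq_add_neg]
  rw [hcoe]
  exact hshift

/-- The continuous linear automorphism of `ℝ^d` given by an invertible matrix. -/
def euclideanEquiv (M : Matrix (Fin d) (Fin d) ℝ) (hM : M.det ≠ 0) : Rd d ≃L[ℝ] Rd d :=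
  ((toEuclideanLin M).equivOfDetNeZero (by rwa [det_toEuclideanLin])).toContinuousLinearEquiv

theorem integral_comp_toEuclideanLin (M : Matrix (Fin d) (Fin d) ℝ) (hM : M.det ≠ 0)
    (f : Rd d → ℂ) : ∫ s, f (toEuclideanLin M s) = |M.det⁻¹| • ∫ s, f s := by
  have hemb : MeasurableEmbedding (toEuclideanLin M : Rd d → Rd d) :=
    (euclideanEquiv M hM).toHomeomorph.measurableEmbedding
  rw [← hemb.integral_map, map_toEuclideanLin M hM, integral_smul_measure,
    ENNReal.toReal_ofReal (abs_nonneg _)]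

theorem inner_toEuclideanLin_transpose_inv {M : Matrix (Fin d) (Fin d) ℝ} (hM : M.det ≠ 0)
    (v w : Rd d) : inner ℝ (toEuclideanLin M v) (toEuclideanLin Mᵀ⁻¹ w) = inner ℝ v w := by
  have hinv : toEuclideanLin Mᵀ (toEuclideanLin Mᵀ⁻¹ w) = w := by
    ext i
    simp [toLpLin_apply, mulVec_mulVec, mul_nonsing_inv, hM]
  rw [← inner_toEuclideanLin_transpose, hinv]

theorem fourier_comp_toEuclideanLin {M : Matrix (Fin d) (Fin d) ℝ} (hM : M.det ≠ 0)
    (f : Rd d → ℂ) (s : Rd d) :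
    𝓕 (fun t => f (toEuclideanLin M t)) s = |M.det⁻¹| • 𝓕 f (toEuclideanLin Mᵀ⁻¹ s) := by
  rw [Real.fourier_eq, Real.fourier_eq, ← integral_comp_toEuclideanLin M hM]
  simp only [inner_toEuclideanLin_transpose_inv hM]

theorem coeFn_U (M : Matrix (Fin d) (Fin d) ℝ) (hM : M.det ≠ 0) (f : L2 d) :
    (U M hM f : Rd d → ℂ) =ᵐ[volume] fun t => (√|M.det| : ℂ) * f (toEuclideanLin M t) :=
  coeFn_UFun M hM f

/-- The operator `U M` on Schwartz functions. -/
def schwartzDilation (M : Matrix (Fin d) (Fin d) ℝ) (hM : M.det ≠ 0) (f : SchwartzMap (Rd d) ℂ) :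
    SchwartzMap (Rd d) ℂ :=
  (√|M.det| : ℂ) • SchwartzMap.compCLMOfContinuousLinearEquiv ℝ (euclideanEquiv M hM) f

theorem coe_schwartzDilation (M : Matrix (Fin d) (Fin d) ℝ) (hM : M.det ≠ 0)
    (f : SchwartzMap (Rd d) ℂ) :
    ⇑(schwartzDilation M hM f) = (√|M.det| : ℂ) • fun t => f (toEuclideanLin M t) :=
  rfl

theorem U_toLp (M : Matrix (Fin d) (Fin d) ℝ) (hM : M.det ≠ 0) (f : SchwartzMap (Rd d) ℂ) :
    U M hM (f.toLp 2) = (schwartzDilation M hM f).toLp 2 := by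
  apply Lp.ext
  filter_upwards [coeFn_U M hM (f.toLp 2), (schwartzDilation M hM f).coeFn_toLp 2,
    (quasiMeasurePreserving_toEuclideanLin M hM).ae (f.coeFn_toLp 2 volume)] with t hU hf hcomp
  rw [hU, hcomp, hf, coe_schwartzDilation, Pi.smul_apply, smul_eq_mul]

theorem sqrt_abs_det_mul_abs_det_inv {M : Matrix (Fin d) (Fin d) ℝ} (hM : M.det ≠ 0) :
    √|M.det| * |M.det⁻¹| = √|Mᵀ⁻¹.det| := by
  have hpos : 0 < |M.det| := abs_pos.mpr hM
  rw [det_nonsing_inv, det_transpose, Ring.inverse_eq_inv, abs_inv, Real.sqrt_inv,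
    ← div_eq_mul_inv, div_eq_iff hpos.ne', ← div_eq_inv_mul, Real.div_sqrt]

theorem fourier_U (M : Matrix (Fin d) (Fin d) ℝ) (hM : M.det ≠ 0) (hM' : Mᵀ⁻¹.det ≠ 0)
    (f : L2 d) : 𝓕 (U M hM f) = U Mᵀ⁻¹ hM' (𝓕 f) := by
  refine congrFun (ext_toLp_schwartz (F := fun f : L2 d => 𝓕 (U M hM f)) ENNReal.ofNat_ne_top
    ((Lp.fourierTransformₗᵢ (Rd d) ℂ).continuous.comp (U M hM).continuous)
    ((U Mᵀ⁻¹ hM').continuous.comp (Lp.fourierTransformₗᵢ (Rd d) ℂ).continuous) fun f => ?_) f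
  change 𝓕 (U M hM (f.toLp 2)) = U Mᵀ⁻¹ hM' (𝓕 (f.toLp 2))
  rw [U_toLp, SchwartzMap.toLp_fourier_eq, SchwartzMap.toLp_fourier_eq]
  apply Lp.ext
  filter_upwards [coeFn_U Mᵀ⁻¹ hM' ((𝓕 f).toLp 2),
    (𝓕 (schwartzDilation M hM f)).coeFn_toLp 2,
    (quasiMeasurePreserving_toEuclideanLin Mᵀ⁻¹ hM').ae ((𝓕 f).coeFn_toLp 2 volume)]
    with s hU hdil hf
  rw [hU, hf, hdil, SchwartzMap.fourier_coe, SchwartzMap.fourier_coe, coe_schwartzDilation]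
  have hsmul : 𝓕 ((√|M.det| : ℂ) • fun t => f (toEuclideanLin M t)) s =
      (√|M.det| : ℂ) * 𝓕 (fun t => f (toEuclideanLin M t)) s :=
    congrFun (VectorFourier.fourierIntegral_const_smul Real.fourierChar
      (volume : Measure (Rd d)) (innerₗ (Rd d)) _ _) s
  rw [hsmul, fourier_comp_toEuclideanLin hM, Complex.real_smul, ← mul_assoc, ← Complex.ofReal_mul,
    sqrt_abs_det_mul_abs_det_inv hM]

theorem U_U (M N : Matrix (Fin d) (Fin d) ℝ) (hM : M.det ≠ 0) (hN : N.det ≠ 0)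
    (hMN : (M * N).det ≠ 0) (f : L2 d) : U N hN (U M hM f) = U (M * N) hMN f := by
  apply Lp.ext
  filter_upwards [coeFn_U N hN (U M hM f), coeFn_U (M * N) hMN f,
    (quasiMeasurePreserving_toEuclideanLin N hN).ae (coeFn_U M hM f)] with t hN hMN hM
  have hmul : toEuclideanLin (M * N) t = toEuclideanLin M (toEuclideanLin N t) := by
    ext i
    simp [toLpLin_apply, mulVec_mulVec]
  rw [hN, hM, hMN, hmul, ← mul_assoc, ← Complex.ofReal_mul, ← Real.sqrt_mul (abs_nonneg _),
    ← abs_mul, det_mul, mul_comm N.det]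

end FourierIntertwining

/-! ### Bessel families -/

section Bessel

variable {ι κ 𝕜 H : Type*} [RCLike 𝕜] [NormedAddCommGroup H] [InnerProductSpace 𝕜 H]

/-- A Bessel family with bound `1`. The inequality is imposed on finite partial sums, so that it
includes the convergence of `∑ᵢ |⟨v i, f⟩|²`. -/
def IsBesselFamily (𝕜 : Type*) {ι H : Type*} [RCLike 𝕜] [NormedAddCommGroup H]
    [InnerProductSpace 𝕜 H] (v : ι → H) : Prop :=
  ∀ (f : H) (s : Finset ι), ∑ i ∈ s, ‖inner 𝕜 (v i) f‖ ^ 2 ≤ ‖f‖ ^ 2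

-- The synthesis operator is the adjoint of `f ↦ (⟨v i, f⟩)ᵢ`, so both have norm at most `1`.
theorem isBesselFamily_of_norm_linearCombination_le {v : ι → H}
    (hv : ∀ x : ι →₀ 𝕜, ‖Finsupp.linearCombination 𝕜 v x‖ ≤ √(x.sum fun _ c => ‖c‖ ^ 2)) :
    IsBesselFamily 𝕜 v := by
  classical
  intro f s
  set x : ι →₀ 𝕜 := Finsupp.indicator s fun i _ => inner 𝕜 (v i) f
  set S : ℝ := ∑ i ∈ s, ‖inner 𝕜 (v i) f‖ ^ 2
  have hS : 0 ≤ S := Finset.sum_nonneg fun _ _ => by positivity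
  have hx : (x.sum fun _ c => ‖c‖ ^ 2) = S := Finsupp.sum_indicator_index _ (by simp)
  have hinner : inner 𝕜 (Finsupp.linearCombination 𝕜 v x) f = (S : 𝕜) := by
    rw [Finsupp.linearCombination_apply, Finsupp.sum_indicator_index _ (by simp), sum_inner,
      RCLike.ofReal_sum]
    refine Finset.sum_congr rfl fun i _ => ?_
    rw [inner_smul_left, RCLike.conj_mul, RCLike.ofReal_pow]
  have hcs : S ≤ √S * ‖f‖ := by
    calc S = ‖inner 𝕜 (Finsupp.linearCombination 𝕜 v x) f‖ := by
          rw [hinner, RCLike.norm_ofReal, abs_of_nonneg hS]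
      _ ≤ ‖Finsupp.linearCombination 𝕜 v x‖ * ‖f‖ := norm_inner_le_norm _ _
      _ ≤ √S * ‖f‖ := by
          gcongr
          rw [← hx]
          exact hv x
  nlinarith [Real.sq_sqrt hS, sq_nonneg (√S - ‖f‖)]

theorem IsBesselFamily.summable {v : ι → H} (hv : IsBesselFamily 𝕜 v) (f : H) :
    Summable fun i => ‖inner 𝕜 (v i) f‖ ^ 2 :=
  summable_of_sum_le (fun _ => by positivity) (hv f)

theorem IsBesselFamily.tsum_le {v : ι → H} (hv : IsBesselFamily 𝕜 v) (f : H) :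
    ∑' i, ‖inner 𝕜 (v i) f‖ ^ 2 ≤ ‖f‖ ^ 2 :=
  Real.tsum_le_of_sum_le (fun _ => by positivity) (hv f)

theorem IsBesselFamily.map {v : ι → H} (hv : IsBesselFamily 𝕜 v) (e : H ≃ₗᵢ[𝕜] H) :
    IsBesselFamily 𝕜 fun i => e (v i) := by
  intro f s
  simpa only [LinearIsometryEquiv.inner_map_eq_flip, LinearIsometryEquiv.norm_map] using
    hv (e.symm f) s

/-- The coefficients `(⟨v i, f⟩)ᵢ` of `f` with respect to a Bessel family, as an element of `ℓ²`. -/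
def IsBesselFamily.coefficients {v : ι → H} (hv : IsBesselFamily 𝕜 v) (f : H) :
    lp (fun _ : ι => 𝕜) 2 :=
  ⟨fun i => inner 𝕜 (v i) f, memℓp_gen (by simpa using hv.summable f)⟩

theorem IsBesselFamily.norm_coefficients {v : ι → H} (hv : IsBesselFamily 𝕜 v) (f : H) :
    ‖hv.coefficients f‖ = √(∑' i, ‖inner 𝕜 (v i) f‖ ^ 2) := by
  rw [lp.norm_eq_tsum_rpow (by simp), Real.sqrt_eq_rpow]
  simp [IsBesselFamily.coefficients]

theorem IsBesselFamily.lipschitzWith_sqrt_tsum {v : ι → H} (hv : IsBesselFamily 𝕜 v) :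
    LipschitzWith 1 fun f => √(∑' i, ‖inner 𝕜 (v i) f‖ ^ 2) := by
  refine LipschitzWith.mk_one fun f g => ?_
  have hsub : hv.coefficients f - hv.coefficients g = hv.coefficients (f - g) := by
    ext i
    exact (inner_sub_right _ _ _).symm
  rw [← hv.norm_coefficients, ← hv.norm_coefficients, dist_eq_norm f g]
  refine (dist_norm_norm_le _ _).trans ?_
  rw [hsub, hv.norm_coefficients, Real.sqrt_le_left (norm_nonneg _)]
  exact hv.tsum_le _

theorem IsBesselFamily.tendsto_sqrt_tsum_of_dense {v : κ → ι → H} (hv : ∀ k, IsBesselFamily 𝕜 (v k))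
    {l : Filter κ} {p : H → ℝ} (hp : Continuous p) {S : Set H} (hS : Dense S)
    (hlim : ∀ f ∈ S, Filter.Tendsto (fun k => √(∑' i, ‖inner 𝕜 (v k i) f‖ ^ 2)) l (nhds (p f)))
    (f : H) : Filter.Tendsto (fun k => √(∑' i, ‖inner 𝕜 (v k i) f‖ ^ 2)) l (nhds (p f)) :=
  have hequi : Equicontinuous fun k f => √(∑' i, ‖inner 𝕜 (v k i) f‖ ^ 2) :=
    (LipschitzWith.uniformEquicontinuous _ 1 fun k =>
      (hv k).lipschitzWith_sqrt_tsum).equicontinuous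
  (hequi.isClosed_setOfPred_tendsto hp).closure_subset_iff.mpr hlim (hS f)

end Bessel

/-! ### The scaling function -/

section ScalingFunction

variable {d : ℕ} {A : Matrix (Fin d) (Fin d) ℤ} {h : (Fin d → ℤ) →₀ ℂ}

theorem factor_two_pi_smul (s : Rd d) (j : ℕ) :
    factor A h ((2 * Real.pi) • s) j = lowpass h (toEuclideanLin ((realMat A)ᵀ⁻¹ ^ j) s) := by
  rw [factor, map_smul, filterFun_two_pi_smul]

theorem multipliable_factor (hexp : IsExpansive A) (h0 : lowpass h 0 = 1) (ξ : Rd d) :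
    Multipliable fun j : ℕ => factor A h ξ (j + 1) := by
  rw [← smul_inv_smul₀ Real.two_pi_pos.ne' ξ]
  simpa only [factor_two_pi_smul] using multipliable_lowpass hexp h0 ((2 * Real.pi)⁻¹ • ξ)

theorem coeFn_U_smul_one {c : ℝ} (hc : 0 < c) (hM : (c • (1 : Matrix (Fin d) (Fin d) ℝ)).det ≠ 0)
    (f : L2 d) :
    (U (c • 1) hM f : Rd d → ℂ) =ᵐ[volume] fun t => ((c ^ ((d : ℝ) / 2) : ℝ) : ℂ) * f (c • t) := by
  have hdet : √|(c • (1 : Matrix (Fin d) (Fin d) ℝ)).det| = c ^ ((d : ℝ) / 2) := by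
    rw [det_smul, det_one, mul_one, Fintype.card_fin, abs_of_pos (by positivity),
      Real.sqrt_eq_rpow, ← Real.rpow_natCast, ← Real.rpow_mul hc.le, mul_one_div]
  have happly : ∀ t : Rd d, toEuclideanLin (c • (1 : Matrix (Fin d) (Fin d) ℝ)) t = c • t := by
    intro t
    ext i
    simp
  filter_upwards [coeFn_U (c • 1) hM f] with t ht
  rw [ht, hdet, happly]

theorem det_two_pi_inv_smul_one_ne_zero :
    ((2 * Real.pi)⁻¹ • (1 : Matrix (Fin d) (Fin d) ℝ)).det ≠ 0 := by
  rw [det_smul, det_one, mul_one]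
  exact pow_ne_zero _ (inv_ne_zero Real.two_pi_pos.ne')

theorem coeFn_fourier (f : L2 d) :
    (fourier d f : Rd d → ℂ) =ᵐ[volume] fun s =>
      (((2 * Real.pi)⁻¹ ^ ((d : ℝ) / 2) : ℝ) : ℂ) * (𝓕 f) ((2 * Real.pi)⁻¹ • s) :=
  coeFn_U_smul_one (inv_pos.mpr Real.two_pi_pos) det_two_pi_inv_smul_one_ne_zero _

theorem gFun_eq_symbol (ξ : Rd d) :
    gFun A h ξ =
      (((2 * Real.pi)⁻¹ ^ ((d : ℝ) / 2) : ℝ) : ℂ) * symbol A h ((2 * Real.pi)⁻¹ • ξ) := by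
  rw [gFun, symbol, Real.inv_rpow Real.two_pi_pos.le, Complex.ofReal_inv, one_div]
  congr 1
  refine tprod_congr fun j => ?_
  rw [← factor_two_pi_smul, smul_inv_smul₀ Real.two_pi_pos.ne']

theorem gFun_ae_eq_fourier {f : L2 d} (hf : (𝓕 f : L2 d) =ᵐ[volume] symbol A h) :
    gFun A h =ᵐ[volume] fourier d f := by
  filter_upwards [coeFn_fourier f, (Measure.quasiMeasurePreserving_smul volume
    (inv_ne_zero Real.two_pi_pos.ne')).ae hf] with ξ hξ hsymbol
  rw [gFun_eq_symbol, hξ, hsymbol]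

theorem exists_fourier_ae_eq_symbol (hexp : IsExpansive A) (hdet : |A.det| = 2)
    (hh : IsLawtonSolution A h) : ∃ f : L2 d, (𝓕 f : L2 d) =ᵐ[volume] symbol A h := by
  refine ⟨𝓕⁻ (memLp_symbol hexp hdet hh).toLp, ?_⟩
  rw [FourierTransform.fourier_fourierInv_eq]
  exact MemLp.coeFn_toLp _

theorem memLp_gFun (hexp : IsExpansive A) (hdet : |A.det| = 2) (hh : IsLawtonSolution A h) :
    MemLp (gFun A h) 2 volume := by
  obtain ⟨f, hf⟩ := exists_fourier_ae_eq_symbol hexp hdet hh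
  exact (memLp_congr_ae (gFun_ae_eq_fourier hf)).mpr (Lp.memLp _)

theorem fourier_scalingFun_ae_eq (hexp : IsExpansive A) (hdet : |A.det| = 2)
    (hh : IsLawtonSolution A h) : (𝓕 (scalingFun A h) : L2 d) =ᵐ[volume] symbol A h := by
  obtain ⟨f, hf⟩ := exists_fourier_ae_eq_symbol hexp hdet hh
  have hg : MemLp (gFun A h) 2 volume := memLp_gFun hexp hdet hh
  have hgf : hg.toLp = fourier d f := Lp.ext (hg.coeFn_toLp.trans (gFun_ae_eq_fourier hf))
  rwa [scalingFun, dif_pos hg, hgf, LinearIsometryEquiv.symm_apply_apply]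

theorem coeFn_linearCombination_modulation (f : L2 d) (x : (Fin d → ℤ) →₀ ℂ) :
    (Finsupp.linearCombination ℂ (fun ℓ => modulation ℓ f) x : Rd d → ℂ) =ᵐ[volume]
      fun s => trigPoly x s * f s := by
  induction x using Finsupp.induction_linear with
  | zero =>
    simp only [map_zero, trigPoly, zero_mul]
    exact Lp.coeFn_zero ℂ 2 volume
  | add x y hx hy =>
    rw [map_add]
    filter_upwards [hx, hy, Lp.coeFn_add
      (Finsupp.linearCombination ℂ (fun ℓ => modulation ℓ f) x)
      (Finsupp.linearCombination ℂ (fun ℓ => modulation ℓ f) y)] with s hx hy hadd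
    rw [hadd, Pi.add_apply, hx, hy, trigPoly, trigPoly, trigPoly, map_add, add_mul]
  | single n c =>
    rw [Finsupp.linearCombination_single]
    filter_upwards [Lp.coeFn_smul c (modulation n f), coeFn_modulation n f] with s hsmul hmod
    rw [hsmul, Pi.smul_apply, hmod, trigPoly, Finsupp.linearCombination_single, smul_eq_mul,
      smul_eq_mul, mul_assoc]

theorem isBesselFamily_T_scalingFun (hexp : IsExpansive A) (hdet : |A.det| = 2)
    (hh : IsLawtonSolution A h) : IsBesselFamily ℂ fun ℓ => T ℓ (scalingFun A h) := by
  refine isBesselFamily_of_norm_linearCombination_le fun x => ?_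
  have hfourier : 𝓕 (Finsupp.linearCombination ℂ (fun ℓ => T ℓ (scalingFun A h)) x) =
      Finsupp.linearCombination ℂ (fun ℓ => modulation ℓ (𝓕 (scalingFun A h))) x := by
    simp only [← fourier_T]
    exact Finsupp.apply_linearCombination ℂ
      (Lp.fourierTransformₗᵢ (Rd d) ℂ).toLinearEquiv.toLinearMap _ x
  have hsymbol : (Finsupp.linearCombination ℂ (fun ℓ => modulation ℓ (𝓕 (scalingFun A h))) x :
      Rd d → ℂ) =ᵐ[volume] fun s => trigPoly x s * symbol A h s := by
    filter_upwards [coeFn_linearCombination_modulation (𝓕 (scalingFun A h)) x,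
      fourier_scalingFun_ae_eq hexp hdet hh] with s hs hφ
    rw [hs, hφ]
  rw [← Lp.norm_fourier_eq, hfourier, Lp.norm_def, eLpNorm_congr_ae hsymbol]
  exact ENNReal.toReal_le_of_le_ofReal (Real.sqrt_nonneg _)
    (eLpNorm_trigPoly_mul_symbol_le hexp hdet hh x)

end ScalingFunction

/-! ### Functions supported near the origin -/

section VanishesOutsideBall

variable {d : ℕ}

/-- The essential support of `f` lies in the closed ball of radius `r` around the origin. -/
def VanishesOutsideBall (f : Rd d → ℂ) (r : ℝ) : Prop :=
  ∀ᵐ t, r < ‖t‖ → f t = 0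

theorem dense_vanishesOutsideBall : Dense {f : L2 d | ∃ r, VanishesOutsideBall f r} := by
  refine (Lp.dense_hasCompactSupport_contDiff (p := 2) ENNReal.ofNat_ne_top).mono ?_
  rintro f ⟨g, hfg, hg, -⟩
  obtain ⟨r, hr⟩ := hg.isCompact.isBounded.subset_closedBall 0
  refine ⟨r, ?_⟩
  filter_upwards [hfg] with t ht hrt
  rw [ht]
  by_contra hgt
  exact hrt.not_ge (mem_closedBall_zero_iff.mp (hr (subset_tsupport g hgt)))

theorem dense_vanishesOutsideBall_fourier :
    Dense {f : L2 d | ∃ r, VanishesOutsideBall (𝓕 f : L2 d) r} :=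
  dense_vanishesOutsideBall.preimage (Lp.fourierTransformₗᵢ (Rd d) ℂ).toHomeomorph.isOpenMap

theorem VanishesOutsideBall.map_U {f : L2 d} {r : ℝ} (hf : VanishesOutsideBall f r)
    (M : Matrix (Fin d) (Fin d) ℝ) (hM : M.det ≠ 0) :
    VanishesOutsideBall (U M hM f) (‖M⁻¹‖ * r) := by
  filter_upwards [coeFn_U M hM f, (quasiMeasurePreserving_toEuclideanLin M hM).ae hf]
    with t hUt ht hrt
  have hnorm : ‖t‖ ≤ ‖M⁻¹‖ * ‖toEuclideanLin M t‖ := by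
    simpa [toLpLin_apply, mulVec_mulVec, nonsing_inv_mul M hM.isUnit] using
      norm_toEuclideanLin_le M⁻¹ (toEuclideanLin M t)
  rw [hUt, ht (lt_of_mul_lt_mul_left (hrt.trans_le hnorm) (norm_nonneg _)), mul_zero]

end VanishesOutsideBall

section NormSq

variable {α E : Type*} [MeasurableSpace α] {μ : Measure α} [NormedAddCommGroup E]

theorem norm_sq_toLp {f : α → E} (hf : MemLp f 2 μ) : ‖hf.toLp f‖ ^ 2 = ∫ t, ‖f t‖ ^ 2 ∂μ := by
  rw [Lp.norm_toLp, hf.eLpNorm_eq_integral_rpow_norm two_ne_zero ENNReal.ofNat_ne_top,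
    ENNReal.toReal_ofReal (by positivity)]
  simp only [ENNReal.toReal_ofNat, Real.rpow_ofNat]
  exact Real.rpow_inv_natCast_pow (integral_nonneg fun _ => by positivity) two_ne_zero

theorem integrable_norm_sq (f : Lp E 2 μ) : Integrable (fun t => ‖f t‖ ^ 2) μ :=
  (memLp_two_iff_integrable_sq_norm (Lp.aestronglyMeasurable f)).mp (Lp.memLp f)

end NormSq

section LowFrequency

variable {d : ℕ} {κ : Type*} {l : Filter κ} {φ : L2 d}

theorem conj_latticeChar (n : Fin d → ℤ) (s : Rd d) :
    starRingEnd ℂ (latticeChar n s) = latticeChar (-n) s := by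
  have hneg : intVec (-n) = -intVec n := by
    ext i
    simp [intVec]
  rw [latticeChar, latticeChar, hneg, inner_neg_left, neg_neg, AddChar.map_neg_eq_inv,
    Circle.coe_inv_eq_conj, Complex.conj_conj]

theorem inner_T_eq_integral (φ f : L2 d) (ℓ : Fin d → ℤ) :
    inner ℂ (T ℓ φ) f =
      ∫ s, latticeChar (-ℓ) s * (starRingEnd ℂ ((𝓕 φ : L2 d) s) * (𝓕 f : L2 d) s) := by
  rw [← Lp.inner_fourier_eq, fourier_T, L2.inner_def]
  refine integral_congr_ae ?_
  filter_upwards [coeFn_modulation ℓ (𝓕 φ : L2 d)] with s hs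
  rw [hs, RCLike.inner_apply, map_mul, conj_latticeChar]
  ring

-- For such `f` the coefficients `⟨T_ℓ φ, f⟩` are the Fourier coefficients of `u` on the unit cube.
theorem hasSum_norm_sq_inner_T {f u : L2 d} {ρ : ℝ} (hρ : ρ < 1 / 2)
    (hf : VanishesOutsideBall (𝓕 f : L2 d) ρ)
    (hu : u =ᵐ[volume] fun s => starRingEnd ℂ ((𝓕 φ : L2 d) s) * (𝓕 f : L2 d) s) :
    HasSum (fun ℓ => ‖inner ℂ (T ℓ φ) f‖ ^ 2) (‖u‖ ^ 2) := by
  have hcube : ∀ᵐ s : Rd d, s ∉ cube d → u s = 0 := by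
    filter_upwards [hf, hu] with s hs hus hsc
    have hρs : ρ < ‖s‖ := by
      contrapose! hsc
      exact ball_subset_cube (mem_ball_zero_iff.mpr (hsc.trans_lt hρ))
    rw [hus, hs hρs, mul_zero]
  have hcoeff : ∀ ℓ, inner ℂ (T ℓ φ) f = ∫ s in cube d, latticeChar (-ℓ) s * u s := by
    intro ℓ
    rw [inner_T_eq_integral, setIntegral_eq_integral_of_ae_compl_eq_zero]
    · refine integral_congr_ae ?_
      filter_upwards [hu] with s hs
      rw [hs]
    · filter_upwards [hcube] with s hs hsc
      rw [hs hsc, mul_zero]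
  have hnorm : ‖u‖ ^ 2 = ∫ s in cube d, ‖u s‖ ^ 2 := by
    rw [setIntegral_eq_integral_of_ae_compl_eq_zero, ← norm_sq_toLp (Lp.memLp u), Lp.toLp_coeFn]
    filter_upwards [hcube] with s hs hsc
    rw [hs hsc, norm_zero, zero_pow two_ne_zero]
  simp only [hcoeff, hnorm]
  exact (Equiv.neg _).hasSum_iff.mpr
    (hasSum_norm_sq_integral_latticeChar ((Lp.memLp u).restrict (cube d)))

theorem abs_sqrt_tsum_norm_inner_T_sub_norm_le {f : L2 d} {ρ ε : ℝ} (hρ : ρ < 1 / 2)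
    (hf : VanishesOutsideBall (𝓕 f : L2 d) ρ)
    (hφ : ∀ᵐ s, ‖s‖ ≤ ρ → ‖(𝓕 φ : L2 d) s - 1‖ ≤ ε) :
    |√(∑' ℓ, ‖inner ℂ (T ℓ φ) f‖ ^ 2) - ‖f‖| ≤ ε * ‖f‖ := by
  set F : L2 d := 𝓕 f
  set w : Rd d → ℂ := fun s => (starRingEnd ℂ ((𝓕 φ : L2 d) s) - 1) * F s
  have hw_le : ∀ᵐ s, ‖w s‖ ≤ ε * ‖F s‖ := by
    filter_upwards [hf, hφ] with s hs hφs
    rcases lt_or_ge ρ ‖s‖ with hsρ | hsρ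
    · simp [w, hs hsρ]
    · rw [norm_mul, ← map_one (starRingEnd ℂ), ← map_sub, RCLike.norm_conj]
      gcongr
      exact hφs hsρ
  have hw : MemLp w 2 := by
    refine (Lp.memLp F).of_le_mul (.mul (.sub ?_ aestronglyMeasurable_const)
      (Lp.aestronglyMeasurable F)) hw_le
    exact Complex.continuous_conj.comp_aestronglyMeasurable (Lp.aestronglyMeasurable _)
  have hu : (F + hw.toLp w : L2 d) =ᵐ[volume]
      fun s => starRingEnd ℂ ((𝓕 φ : L2 d) s) * F s := by
    filter_upwards [Lp.coeFn_add F (hw.toLp w), hw.coeFn_toLp] with s hadd hws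
    rw [hadd, Pi.add_apply, hws]
    ring
  rw [(hasSum_norm_sq_inner_T hρ hf hu).tsum_eq, Real.sqrt_sq (norm_nonneg _),
    ← Lp.norm_fourier_eq f]
  calc |‖F + hw.toLp w‖ - ‖F‖| ≤ ‖F + hw.toLp w - F‖ := abs_norm_sub_norm_le _ _
    _ = ‖hw.toLp w‖ := by rw [add_sub_cancel_left]
    _ ≤ ε * ‖F‖ := by
      refine Lp.norm_le_mul_norm_of_ae_le_mul ?_
      filter_upwards [hw.coeFn_toLp, hw_le] with s hs hle
      rwa [hs]

theorem tendsto_sqrt_tsum_norm_inner_T {G : Rd d → ℂ} (hφ : (𝓕 φ : L2 d) =ᵐ[volume] G)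
    (hG : Filter.Tendsto G (nhds 0) (nhds 1)) {g : κ → L2 d} {r : κ → ℝ} {c : ℝ}
    (hr : Filter.Tendsto r l (nhds 0)) (hg : ∀ k, VanishesOutsideBall (𝓕 (g k) : L2 d) (r k))
    (hc : ∀ k, ‖g k‖ = c) :
    Filter.Tendsto (fun k => √(∑' ℓ, ‖inner ℂ (T ℓ φ) (g k)‖ ^ 2)) l (nhds c) := by
  have hclose : (fun k => √(∑' ℓ, ‖inner ℂ (T ℓ φ) (g k)‖ ^ 2) - c) =o[l] fun _ => c := by
    refine Asymptotics.isLittleO_iff.mpr fun ε hε => ?_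
    obtain ⟨δ, hδ, hGδ⟩ := Metric.tendsto_nhds_nhds.mp hG ε hε
    filter_upwards [hr.eventually_lt_const hδ, hr.eventually_lt_const one_half_pos]
      with k hkδ hk
    rw [← hc k, Real.norm_eq_abs, norm_norm]
    refine abs_sqrt_tsum_norm_inner_T_sub_norm_le hk (hg k) ?_
    filter_upwards [hφ] with s hs hsr
    rw [hs, ← dist_eq_norm]
    exact (hGδ (by simpa using hsr.trans_lt hkδ)).le
  exact tendsto_sub_nhds_zero_iff.mp ((Asymptotics.isLittleO_one_iff ℝ).mp
    (hclose.trans_isBigO (Asymptotics.isBigO_const_const c one_ne_zero l)))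

end LowFrequency

section Concentration

variable {d : ℕ} {κ : Type*} {l : Filter κ}

theorem norm_inner_T_sq_le (φ : L2 d) {g : L2 d} (ℓ : Fin d → ℤ) {ρ : ℝ}
    (hg : VanishesOutsideBall g ρ) :
    ‖inner ℂ (T ℓ φ) g‖ ^ 2 ≤
      (∫ t in Metric.closedBall (-intVec ℓ) ρ, ‖φ t‖ ^ 2) * ‖g‖ ^ 2 := by
  set B : Set (Rd d) := Metric.closedBall (-intVec ℓ) ρ
  have hB : MeasurableSet B := Metric.isClosed_closedBall.measurableSet
  have hφB : MemLp (B.indicator φ) 2 volume := (Lp.memLp φ).indicator hB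
  have hinner : inner ℂ (T ℓ φ) g = inner ℂ (T ℓ (hφB.toLp _)) g := by
    rw [L2.inner_def, L2.inner_def]
    refine integral_congr_ae ?_
    filter_upwards [coeFn_T ℓ φ, coeFn_T ℓ (hφB.toLp _), hg,
      (measurePreserving_sub_right volume (intVec ℓ)).quasiMeasurePreserving.ae hφB.coeFn_toLp]
      with t hφt hφBt hgt hind
    rw [hφt, hφBt, hind]
    rcases lt_or_ge ρ ‖t‖ with ht | ht
    · rw [hgt ht, inner_zero_right, inner_zero_right]
    · rw [Set.indicator_of_mem]
      simpa [B, dist_eq_norm] using ht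
  have hnorm : ‖hφB.toLp _‖ ^ 2 = ∫ t in B, ‖φ t‖ ^ 2 := by
    rw [norm_sq_toLp, ← integral_indicator hB]
    refine integral_congr_ae (.of_forall fun t => ?_)
    by_cases ht : t ∈ B <;> simp [ht]
  rw [hinner, ← hnorm, ← (T ℓ).norm_map (hφB.toLp _), ← mul_pow]
  gcongr
  exact norm_inner_le_norm _ _

theorem one_le_dist_intVec {m n : Fin d → ℤ} (hmn : m ≠ n) : 1 ≤ dist (intVec m) (intVec n) := by
  obtain ⟨i, hi⟩ := Function.ne_iff.mp hmn
  calc (1 : ℝ) ≤ |((m i - n i : ℤ) : ℝ)| := by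
        exact_mod_cast Int.one_le_abs (sub_ne_zero.mpr hi)
    _ = ‖(intVec m - intVec n) i‖ := by simp [intVec]
    _ ≤ dist (intVec m) (intVec n) := by
        rw [dist_eq_norm]
        exact PiLp.norm_apply_le _ i

theorem summable_integral_closedBall (φ : L2 d) {ρ : ℝ} (hρ : ρ < 1 / 2) :
    Summable fun ℓ : Fin d → ℤ => ∫ t in Metric.closedBall (-intVec ℓ) ρ, ‖φ t‖ ^ 2 := by
  refine (hasSum_integral_iUnion (fun ℓ => Metric.isClosed_closedBall.measurableSet) ?_
    (integrable_norm_sq φ).integrableOn).summable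
  intro ℓ m hℓm
  refine Metric.closedBall_disjoint_closedBall ?_
  rw [dist_neg_neg]
  linarith [one_le_dist_intVec hℓm]

theorem tendsto_volume_closedBall_nhds_zero [NeZero d] (x : Rd d) :
    Filter.Tendsto (fun ρ => volume (Metric.closedBall x ρ)) (nhds 0) (nhds 0) := by
  have hthick :=
    tendsto_measure_cthickening_of_isCompact (μ := volume) (isCompact_singleton (x := x))
  rw [measure_singleton] at hthick
  exact tendsto_of_tendsto_of_tendsto_of_le_of_le tendsto_const_nhds hthick
    (fun _ => zero_le) fun ρ => measure_mono (Metric.closedBall_subset_cthickening_singleton x ρ)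

theorem tendsto_tsum_integral_closedBall [NeZero d] (φ : L2 d) :
    Filter.Tendsto
      (fun ρ => ∑' ℓ : Fin d → ℤ, ∫ t in Metric.closedBall (-intVec ℓ) ρ, ‖φ t‖ ^ 2)
      (nhds 0) (nhds 0) := by
  have hlim : ∀ ℓ : Fin d → ℤ, Filter.Tendsto
      (fun ρ => ∫ t in Metric.closedBall (-intVec ℓ) ρ, ‖φ t‖ ^ 2) (nhds 0) (nhds 0) := fun ℓ =>
    (integrable_norm_sq φ).tendsto_setIntegral_nhds_zero (tendsto_volume_closedBall_nhds_zero _)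
  have hdom : ∀ᶠ ρ in nhds (0 : ℝ), ∀ ℓ : Fin d → ℤ,
      ‖∫ t in Metric.closedBall (-intVec ℓ) ρ, ‖φ t‖ ^ 2‖ ≤
        ∫ t in Metric.closedBall (-intVec ℓ) (1 / 3), ‖φ t‖ ^ 2 := by
    filter_upwards [gt_mem_nhds (by norm_num : (0 : ℝ) < 1 / 3)] with ρ hρ ℓ
    rw [Real.norm_of_nonneg (integral_nonneg fun _ => by positivity)]
    exact setIntegral_mono_set (integrable_norm_sq φ).integrableOn
      (.of_forall fun _ => by positivity) (Metric.closedBall_subset_closedBall hρ.le).eventuallyLE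
  simpa only [tsum_zero] using tendsto_tsum_of_dominated_convergence
    (summable_integral_closedBall φ (by norm_num)) hlim hdom

theorem tendsto_sqrt_tsum_norm_inner_T_zero [NeZero d] (φ : L2 d) {g : κ → L2 d} {r : κ → ℝ} {c : ℝ}
    (hr : Filter.Tendsto r l (nhds 0)) (hg : ∀ k, VanishesOutsideBall (g k) (r k))
    (hc : ∀ k, ‖g k‖ = c) :
    Filter.Tendsto (fun k => √(∑' ℓ, ‖inner ℂ (T ℓ φ) (g k)‖ ^ 2)) l (nhds 0) := by
  have hbound : Filter.Tendsto (fun k => (∑' ℓ : Fin d → ℤ,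
      ∫ t in Metric.closedBall (-intVec ℓ) (r k), ‖φ t‖ ^ 2) * c ^ 2) l (nhds 0) := by
    simpa using ((tendsto_tsum_integral_closedBall φ).comp hr).mul_const (c ^ 2)
  have hsum : Filter.Tendsto (fun k => ∑' ℓ, ‖inner ℂ (T ℓ φ) (g k)‖ ^ 2) l (nhds 0) := by
    refine squeeze_zero' (.of_forall fun _ => tsum_nonneg fun _ => by positivity) ?_ hbound
    filter_upwards [hr.eventually_lt_const one_half_pos] with k hk
    rw [← tsum_mul_right]
    have hle : ∀ ℓ, ‖inner ℂ (T ℓ φ) (g k)‖ ^ 2 ≤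
        (∫ t in Metric.closedBall (-intVec ℓ) (r k), ‖φ t‖ ^ 2) * c ^ 2 := fun ℓ =>
      hc k ▸ norm_inner_T_sq_le φ ℓ (hg k)
    have hsummable := (summable_integral_closedBall φ hk).mul_right (c ^ 2)
    exact (hsummable.of_nonneg_of_le (fun _ => by positivity) hle).tsum_le_tsum hle hsummable
  simpa using hsum.sqrt

end Concentration

/-! ### The limits of `L_J` -/

section Limits

variable {d : ℕ} {A : Matrix (Fin d) (Fin d) ℤ} {h : (Fin d → ℤ) →₀ ℂ}

theorem U_pow (M : Matrix (Fin d) (Fin d) ℝ) (hM : M.det ≠ 0) (n : ℕ) (hn : (M ^ n).det ≠ 0) :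
    U M hM ^ n = U (M ^ n) hn := by
  induction n with
  | zero =>
    ext1 f
    apply Lp.ext
    filter_upwards [coeFn_U (M ^ 0) hn f] with t ht
    rw [ht]
    simp
  | succ n ih =>
    ext1 f
    have hn' : (M ^ n).det ≠ 0 := det_pow M n ▸ pow_ne_zero n hM
    rw [pow_succ, ih hn', LinearIsometryEquiv.coe_mul, Function.comp_apply,
      U_U M (M ^ n) hM hn' (by rwa [← pow_succ'])]
    simp only [pow_succ']

theorem VanishesOutsideBall.map_U_pow {f : L2 d} {r : ℝ} (hf : VanishesOutsideBall f r)
    (M : Matrix (Fin d) (Fin d) ℝ) (hM : M.det ≠ 0) (n : ℕ) :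
    VanishesOutsideBall ((U M hM ^ n) f) (‖M⁻¹ ^ n‖ * r) := by
  rw [U_pow M hM n (det_pow M n ▸ pow_ne_zero n hM), inv_pow']
  exact hf.map_U _ _

theorem VanishesOutsideBall.fourier_U_pow_symm {f : L2 d} {r : ℝ}
    (hf : VanishesOutsideBall (𝓕 f : L2 d) r) (M : Matrix (Fin d) (Fin d) ℝ) (hM : M.det ≠ 0)
    (n : ℕ) : VanishesOutsideBall (𝓕 ((U M hM ^ n).symm f) : L2 d) (‖Mᵀ⁻¹ ^ n‖ * r) := by
  have hMn : (M ^ n).det ≠ 0 := det_pow M n ▸ pow_ne_zero n hM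
  have hinv : (M ^ n)⁻¹.det ≠ 0 := by simpa [det_nonsing_inv] using hMn
  have htranspose : ((M ^ n)⁻¹ᵀ⁻¹).det ≠ 0 := by
    simpa [det_nonsing_inv] using hinv
  have hsymm : (U M hM ^ n).symm f = U (M ^ n)⁻¹ hinv f := by
    rw [U_pow M hM n hMn]
    rfl
  have hnorm : ((M ^ n)⁻¹ᵀ⁻¹)⁻¹ = Mᵀ⁻¹ ^ n := by
    rw [nonsing_inv_nonsing_inv _ (by simpa using hinv), transpose_nonsing_inv, transpose_pow,
      inv_pow']
  rw [hsymm, fourier_U _ hinv htranspose, ← hnorm]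
  exact hf.map_U _ _

theorem LJ_nonneg (hA : |A.det| = 2) (J : ℤ) (f : L2 d) : 0 ≤ LJ A hA h J f :=
  tsum_nonneg fun _ => by positivity

theorem isBesselFamily_D_zpow_T (hexp : IsExpansive A) (hdet : |A.det| = 2)
    (hh : IsLawtonSolution A h) (J : ℤ) :
    IsBesselFamily ℂ fun ℓ => (D A hdet ^ J) (T ℓ (scalingFun A h)) :=
  (isBesselFamily_T_scalingFun hexp hdet hh).map (D A hdet ^ J)

theorem tendsto_sqrt_LJ_atTop (hexp : IsExpansive A) (hdet : |A.det| = 2)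
    (hh : IsLawtonSolution A h) (f : L2 d) :
    Filter.Tendsto (fun J => √(LJ A hdet h J f)) Filter.atTop (nhds ‖f‖) := by
  refine IsBesselFamily.tendsto_sqrt_tsum_of_dense (isBesselFamily_D_zpow_T hexp hdet hh)
    continuous_norm dense_vanishesOutsideBall_fourier ?_ f
  rintro f ⟨r, hf⟩
  have hr : Filter.Tendsto (fun n => ‖(realMat A)ᵀ⁻¹ ^ n‖ * r) Filter.atTop (nhds 0) := by
    simpa using hexp.summable_norm_transpose_inv_pow.tendsto_atTop_zero.mul_const r
  rw [← Nat.map_cast_int_atTop, Filter.tendsto_map'_iff]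
  simpa only [Function.comp_def, LinearIsometryEquiv.inner_map_eq_flip, zpow_natCast] using
    tendsto_sqrt_tsum_norm_inner_T (g := fun n => (D A hdet ^ n).symm f)
      (fourier_scalingFun_ae_eq hexp hdet hh) (tendsto_symbol_nhds_zero hexp hh.lowpass_zero) hr
      (hf.fourier_U_pow_symm _ _)
      fun n => (D A hdet ^ n).symm.norm_map f

theorem tendsto_sqrt_LJ_atBot (hexp : IsExpansive A) (hdet : |A.det| = 2)
    (hh : IsLawtonSolution A h) (f : L2 d) :
    Filter.Tendsto (fun J => √(LJ A hdet h J f)) Filter.atBot (nhds 0) := by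
  have : NeZero d := ⟨by rintro rfl; simp at hdet⟩
  refine IsBesselFamily.tendsto_sqrt_tsum_of_dense (isBesselFamily_D_zpow_T hexp hdet hh)
    continuous_const dense_vanishesOutsideBall ?_ f
  rintro f ⟨r, hf⟩
  have hr : Filter.Tendsto (fun n => ‖(realMat A)⁻¹ ^ n‖ * r) Filter.atTop (nhds 0) := by
    simpa using hexp.summable_norm_inv_pow.tendsto_atTop_zero.mul_const r
  rw [← Filter.map_neg_atTop, ← Nat.map_cast_int_atTop, Filter.map_map, Filter.tendsto_map'_iff]
  have hsymm : ∀ n : ℕ, (D A hdet ^ n)⁻¹.symm f = (D A hdet ^ n) f := fun _ => rfl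
  simpa only [Function.comp_def, LinearIsometryEquiv.inner_map_eq_flip, _root_.zpow_neg,
    zpow_natCast, hsymm] using
    tendsto_sqrt_tsum_norm_inner_T_zero (g := fun n => (D A hdet ^ n) f) (scalingFun A h) hr
      (hf.map_U_pow _ _) fun n => (D A hdet ^ n).norm_map f

theorem tendsto_LJ_atTop (hexp : IsExpansive A) (hdet : |A.det| = 2) (hh : IsLawtonSolution A h)
    (f : L2 d) : Filter.Tendsto (fun J => LJ A hdet h J f) Filter.atTop (nhds (‖f‖ ^ 2)) := by
  simpa only [Real.sq_sqrt (LJ_nonneg _ _ _)] using (tendsto_sqrt_LJ_atTop hexp hdet hh f).pow 2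

theorem tendsto_LJ_atBot (hexp : IsExpansive A) (hdet : |A.det| = 2) (hh : IsLawtonSolution A h)
    (f : L2 d) : Filter.Tendsto (fun J => LJ A hdet h J f) Filter.atBot (nhds 0) := by
  simpa only [Real.sq_sqrt (LJ_nonneg _ _ _), zero_pow two_ne_zero] using
    (tendsto_sqrt_LJ_atBot hexp hdet hh f).pow 2

end Limits

end ParsevalWavelet

end

open ParsevalWavelet in
theorem proposition8p4_general {d : ℕ} (A : Matrix (Fin d) (Fin d) ℤ) (hexp : IsExpansive A)
    (hdet : |A.det| = 2) (h : (Fin d → ℤ) →₀ ℂ) (hh : IsLawtonSolution A h) :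
    (∀ ξ, Multipliable fun j : ℕ => factor A h ξ (j + 1)) ∧
    MeasureTheory.MemLp (gFun A h) 2 MeasureTheory.volume ∧
    ∀ f : L2 d,
      (∀ J : ℤ, Summable fun ℓ => ‖coeff A hdet h J f ℓ‖ ^ 2) ∧
      Filter.Tendsto (fun J : ℤ => LJ A hdet h J f) Filter.atTop (nhds (‖f‖ ^ 2)) ∧
      Filter.Tendsto (fun J : ℤ => LJ A hdet h J f) Filter.atBot (nhds 0) :=
  ⟨multipliable_factor hexp hh.lowpass_zero, memLp_gFun hexp hdet hh, fun f =>
    ⟨fun J => (isBesselFamily_D_zpow_T hexp hdet hh J).summable f,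
      tendsto_LJ_atTop hexp hdet hh f, tendsto_LJ_atBot hexp hdet hh f⟩⟩

theorem proposition8p4 {d : ℕ} (A : Matrix (Fin d) (Fin d) ℤ)
    (hexp : ParsevalWavelet.IsExpansive A) (hdet : |A.det| = 2)
    (hpart : ParsevalWavelet.HasPartition A)
    (h : (Fin d → ℤ) →₀ ℂ) (hh : ParsevalWavelet.IsLawtonSolution A h) :
    (∀ ξ, Multipliable fun j : ℕ => ParsevalWavelet.factor A h ξ (j + 1)) ∧
    MeasureTheory.MemLp (ParsevalWavelet.gFun A h) 2 MeasureTheory.volume ∧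
    ∀ f : ParsevalWavelet.L2 d,
      (∀ J : ℤ, Summable fun ℓ => ‖ParsevalWavelet.coeff A hdet h J f ℓ‖ ^ 2) ∧
      Filter.Tendsto (fun J : ℤ => ParsevalWavelet.LJ A hdet h J f) Filter.atTop
        (nhds (‖f‖ ^ 2)) ∧
      Filter.Tendsto (fun J : ℤ => ParsevalWavelet.LJ A hdet h J f) Filter.atBot (nhds 0) :=
  proposition8p4_general A hexp hdet h hh
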